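/- Let $s>1$ and let $w(x)=|x-i|^{-s}$ for $x\in\mathbb R$. For a Borel probability measure $\mu$ on $\mathbb R$ define the weighted logarithmic energy $$I_w(\mu)=\iint \log\frac{1}{|z-t|\,w(z)\,w(t)}\,d\mu(z)\,d\mu(t)\in(-\infty,+\infty],$$ where the integrand is $+\infty$ for $z=t$. Let $V_w=\inf_\mu I_w(\mu)$, the infimum being over all Borel probability measures on $\mathbb R$, and let $\mathrm{cap}(\mathbb R,w)=e^{-V_w}$ be the weighted capacity. Then there is exactly one Borel probability measure $\mu_w$ on $\mathbb R$ with $I_w(\mu_w)=V_w$ (the weighted equilibrium measure). Its support is $$S_w=\left[-\frac{\sqrt{2s-1}}{s-1},\ \frac{\sqrt{2s-1}}{s-1}\right],$$ and it is given by $$d\mu_w(x)=\frac{\sqrt{2s-1-(s-1)^2x^2}}{\pi(1+x^2)}\,dx,\qquad x\in S_w.$$ Moreover, $$\mathrm{cap}(\mathbb R,w)=2^{2s-2s^2-1}\,s^{-s^2}\,(s-1)^{-(s-1)^2}\,(2s-1)^{(2s-1)^2/2}.$$ -/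

import Mathlib

open MeasureTheory

namespace WeightedPotential

/-- The weight `w(x) = |x - a i|^{-s}` on the real line. -/
noncomputable def weight (a s : ℝ) (x : ℝ) : ℝ :=
  ‖(x : ℂ) - (a : ℂ) * Complex.I‖ ^ (-s)

/-- The kernel `log (1 / (|z - t| w(z) w(t)))` of the weighted logarithmic energy, with values in
the extended reals; it equals `+∞` where `|z - t| w(z) w(t) = 0`, in particular for `z = t`. -/
noncomputable def energyKernel (w : ℝ → ℝ) (z t : ℝ) : EReal :=
  -ENNReal.log (ENNReal.ofReal (|z - t| * w z * w t))

/-- The Lebesgue integral of an extended-real-valued function, as the integral of the positive part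
minus the integral of the negative part. -/
noncomputable def extIntegral {α : Type*} [MeasurableSpace α] (μ : Measure α) (f : α → EReal) :
    EReal :=
  ((∫⁻ x, (f x).toENNReal ∂μ : ENNReal) : EReal) - ((∫⁻ x, (-f x).toENNReal ∂μ : ENNReal) : EReal)

/-- The weighted logarithmic energy `I_w(μ) = ∬ log (1 / (|z - t| w(z) w(t))) dμ(z) dμ(t)`. -/
noncomputable def energy (w : ℝ → ℝ) (μ : Measure ℝ) : EReal :=
  extIntegral (μ.prod μ) fun p => energyKernel w p.1 p.2

/-- The minimal energy `V_w`: the infimum of `I_w` over all Borel probability measures on `ℝ`. -/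
noncomputable def minEnergy (w : ℝ → ℝ) : EReal :=
  ⨅ μ : ProbabilityMeasure ℝ, energy w (μ : Measure ℝ)

/-- `μ` is a weighted equilibrium measure: a Borel probability measure on `ℝ` that attains the
minimal energy. -/
structure IsEquilibriumMeasure (w : ℝ → ℝ) (μ : Measure ℝ) : Prop where
  isProbabilityMeasure : IsProbabilityMeasure μ
  energy_eq : energy w μ = minEnergy w

/-- The weighted capacity `cap(ℝ, w) = e^{-V_w}`. -/
noncomputable def capacity (w : ℝ → ℝ) : ENNReal :=
  EReal.exp (-minEnergy w)

end WeightedPotential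

/-!
For a probability measure the energy splits in two nonnegative parts. Since
`(1 + x ^ 2) * (1 + t ^ 2) = (x - t) ^ 2 + (1 + x * t) ^ 2`, the kernel equals
`h x t + q x + q t`, where `q x = (s - 1) / 2 * log (1 + x ^ 2)` is nonnegative for `1 < s`, and
`h x t = -1 / 2 * log (1 - c)` with `c = (1 + x * t) ^ 2 / ((1 + x ^ 2) * (1 + t ^ 2)) ≤ 1` is the
logarithmic kernel for the chordal distance on the projective line (`energyKernel_weight`).

*Uniqueness.* The series `h = ∑ c ^ n / (2 * n)` has nonnegative terms, and the binomial theorem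
writes `c ^ n` as a combination, with positive coefficients, of products `φ x * φ t` of the bounded
functions `φ x = x ^ j / (1 + x ^ 2) ^ n`, `j ≤ 2 * n`. Hence the energy of `h` is a sum of weighted
squares of the moments `∫ φ dμ`, so that `2 H(μ, ν) ≤ H(μ, μ) + H(ν, ν)`
(`two_mul_chordalEnergy_le`). If equality holds and the energies are finite, all these moments of
`μ` and `ν` agree, and `μ = ν` because the functions `φ` span a point-separating algebra
(`eq_of_chordalEnergy_add_le`). Consequently a probability measure `ν` whose potential
`∫ h x t dν(t) + q x` is constant on its support, and at least that constant everywhere, is the only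
minimizer (`frostman_minimal`).

*The candidate.* Put `b = √(2 * s - 1) / (s - 1)`, `ρ = 1 / (2 * s - 1)` and `t = b * cos θ`. The
candidate measure becomes `(s * P θ - (s - 1)) dθ / π` on `[0, π]`, where `P` is the mean of the
Poisson kernels at the points `± i √ρ`. If `x = b / 2 * (u + u⁻¹)` with `1 ≤ ‖u‖`, then `|x - t|` is
`b / (2 * ‖u‖)` times the distances from `exp (i θ)` to `u` and to its conjugate, and Poisson's
formula for `log ‖z - u‖`, valid also for `‖u‖ = 1`, gives
`∫ log |x - t| dν(t) = log (b / 2) + s * log ‖u ^ 2 + ρ‖ - (2 * s - 1) * log ‖u‖`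
(`integral_log_norm_sub`). Points of the support correspond to `‖u‖ = 1`, real points outside it to
real `u`, where an elementary inequality remains (`log_ratio_le`), and `x = i` corresponds to
`u = i √(2 * s - 1)`, which yields the mean of `log (1 + t ^ 2) / 2` and with it the capacity.
-/

namespace WeightedPotential

/-! ### The energy kernel as a chordal kernel plus a nonnegative field -/

/-- The squared cosine of the angle between the vectors `(1, x)` and `(1, t)`; `1 - cosSq x t` is the
squared chordal distance of `x` and `t`, see `one_sub_cosSq`. -/
noncomputable def cosSq (x t : ℝ) : ℝ :=
  (1 + x * t) ^ 2 / ((1 + x ^ 2) * (1 + t ^ 2))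

/-- The kernel `-log (1 - cosSq x t) / 2`, the logarithm of the inverse chordal distance, encoded by
its power series so that the value is `∞` for `x = t` and every term is visibly nonnegative. -/
noncomputable def chordalKernel (x t : ℝ) : ENNReal :=
  ∑' n : ℕ, ENNReal.ofReal (cosSq x t ^ (n + 1) / (2 * (n + 1)))

/-- The external field left on the real line when the kernel `log (1 / |x - t|)` is replaced by the
chordal one. It is nonnegative for `1 < s`. -/
noncomputable def residualField (s x : ℝ) : ℝ :=
  (s - 1) / 2 * Real.log (1 + x ^ 2)

lemma cosSq_nonneg (x t : ℝ) : 0 ≤ cosSq x t := by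
  unfold cosSq; positivity

lemma one_sub_cosSq (x t : ℝ) :
    1 - cosSq x t = (x - t) ^ 2 / ((1 + x ^ 2) * (1 + t ^ 2)) := by
  unfold cosSq
  have h₁ : 1 + x ^ 2 ≠ 0 := by positivity
  have h₂ : 1 + t ^ 2 ≠ 0 := by positivity
  field_simp
  ring

lemma cosSq_le_one (x t : ℝ) : cosSq x t ≤ 1 := by
  have h : 0 ≤ 1 - cosSq x t := by rw [one_sub_cosSq]; positivity
  linarith

lemma measurable_cosSq : Measurable fun p : ℝ × ℝ => cosSq p.1 p.2 := by
  unfold cosSq; fun_prop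

lemma measurable_chordalKernel : Measurable fun p : ℝ × ℝ => chordalKernel p.1 p.2 := by
  unfold chordalKernel
  refine Measurable.tsum fun n => ?_
  exact ((measurable_cosSq.pow_const _).div_const _).ennreal_ofReal

lemma residualField_nonneg {s : ℝ} (hs : 1 < s) (x : ℝ) : 0 ≤ residualField s x := by
  unfold residualField
  have : 0 ≤ Real.log (1 + x ^ 2) := Real.log_nonneg (by nlinarith [sq_nonneg x])
  have : 0 ≤ (s - 1) / 2 := by linarith
  positivity

lemma continuous_residualField (s : ℝ) : Continuous (residualField s) := by
  unfold residualField
  exact continuous_const.mul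
    (Continuous.log (by fun_prop) fun x => by positivity)

/-- On the diagonal the series is half the harmonic series. -/
lemma chordalKernel_self (x : ℝ) : chordalKernel x x = ⊤ := by
  have h1 : cosSq x x = 1 := by
    have := one_sub_cosSq x x
    simp at this
    linarith
  by_contra hne
  have hsum := ENNReal.summable_toReal hne
  have heq : (fun n : ℕ => (ENNReal.ofReal (cosSq x x ^ (n + 1) / (2 * (n + 1)))).toReal)
      = fun n : ℕ => (1 / 2 : ℝ) * (1 / ((n + 1 : ℕ) : ℝ)) := by
    ext n
    rw [h1, ENNReal.toReal_ofReal (by positivity)]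
    push_cast
    field_simp
    simp
  rw [heq, summable_mul_left_iff (by norm_num)] at hsum
  exact Real.not_summable_one_div_natCast ((summable_nat_add_iff 1).1 hsum)

lemma chordalKernel_of_ne {x t : ℝ} (h : x ≠ t) :
    chordalKernel x t = ENNReal.ofReal
      (Real.log (1 + x ^ 2) / 2 + Real.log (1 + t ^ 2) / 2 - Real.log |x - t|) := by
  have hx : 0 < 1 + x ^ 2 := by positivity
  have ht : 0 < 1 + t ^ 2 := by positivity
  have hxt : x - t ≠ 0 := sub_ne_zero.2 h
  have hlt : cosSq x t < 1 := by
    have : 0 < 1 - cosSq x t := by rw [one_sub_cosSq]; positivity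
    linarith
  have hs := (Real.hasSum_pow_div_log_of_abs_lt_one
    (abs_lt.2 ⟨by linarith [cosSq_nonneg x t], hlt⟩)).div_const 2
  have hs' : HasSum (fun n : ℕ => cosSq x t ^ (n + 1) / (2 * (n + 1)))
      (Real.log (1 + x ^ 2) / 2 + Real.log (1 + t ^ 2) / 2 - Real.log |x - t|) := by
    have hfun : (fun n : ℕ => cosSq x t ^ (n + 1) / (2 * ((n : ℝ) + 1))) =
        fun n : ℕ => cosSq x t ^ (n + 1) / ((n : ℝ) + 1) / 2 := by
      ext n
      rw [div_div, mul_comm 2]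
    have hval : Real.log (1 + x ^ 2) / 2 + Real.log (1 + t ^ 2) / 2 - Real.log |x - t| =
        -Real.log (1 - cosSq x t) / 2 := by
      rw [one_sub_cosSq, Real.log_div (by positivity) (by positivity),
        Real.log_mul hx.ne' ht.ne', ← sq_abs (x - t), Real.log_pow]
      push_cast
      ring
    rw [hfun, hval]
    exact hs
  rw [chordalKernel, ← ENNReal.ofReal_tsum_of_nonneg (fun n => ?_) hs'.summable, hs'.tsum_eq]
  have := cosSq_nonneg x t
  positivity

/-- The chordal distance is at most `1`. -/
lemma chordal_log_nonneg {x t : ℝ} (h : x ≠ t) :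
    0 ≤ Real.log (1 + x ^ 2) / 2 + Real.log (1 + t ^ 2) / 2 - Real.log |x - t| := by
  have hx : 0 < 1 + x ^ 2 := by positivity
  have ht : 0 < 1 + t ^ 2 := by positivity
  have hxt : x - t ≠ 0 := sub_ne_zero.2 h
  have h1 : Real.log (1 - cosSq x t) ≤ 0 :=
    Real.log_nonpos (by linarith [cosSq_le_one x t]) (by linarith [cosSq_nonneg x t])
  rw [one_sub_cosSq, Real.log_div (by positivity) (by positivity),
        Real.log_mul hx.ne' ht.ne', ← sq_abs (x - t), Real.log_pow] at h1
  push_cast at h1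
  linarith

lemma weight_pos (s x : ℝ) : 0 < weight 1 s x := by
  unfold weight
  refine Real.rpow_pos_of_pos (norm_pos_iff.2 fun h => ?_) _
  simpa using congrArg Complex.im h

lemma norm_sub_I (x : ℝ) : ‖(x : ℂ) - Complex.I‖ = √(1 + x ^ 2) := by
  rw [Complex.norm_def, Complex.normSq_apply]
  congr 1
  simp
  ring

lemma log_weight (s x : ℝ) :
    Real.log (weight 1 s x) = -(s / 2 * Real.log (1 + x ^ 2)) := by
  have : ‖(x : ℂ) - ((1 : ℝ) : ℂ) * Complex.I‖ = √(1 + x ^ 2) := by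
    simpa using norm_sub_I x
  rw [weight, this, Real.log_rpow (by positivity), Real.log_sqrt (by positivity)]
  ring

/-- The energy kernel is nonnegative and equals the chordal kernel plus the field at both points. -/
lemma energyKernel_weight {s : ℝ} (hs : 1 < s) (x t : ℝ) :
    energyKernel (weight 1 s) x t = ((chordalKernel x t + ENNReal.ofReal (residualField s x) +
      ENNReal.ofReal (residualField s t) : ENNReal) : EReal) := by
  unfold energyKernel
  rcases eq_or_ne x t with rfl | h
  · simp [chordalKernel_self]
  · have hwx := weight_pos s x
    have hwt := weight_pos s t
    have habs : 0 < |x - t| := abs_pos.2 (sub_ne_zero.2 h)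
    rw [ENNReal.log_ofReal_of_pos (by positivity), chordalKernel_of_ne h,
      ← ENNReal.ofReal_add (chordal_log_nonneg h) (residualField_nonneg hs x),
      ← ENNReal.ofReal_add (add_nonneg (chordal_log_nonneg h) (residualField_nonneg hs x))
        (residualField_nonneg hs t), EReal.coe_ennreal_ofReal, max_eq_left, ← EReal.coe_neg,
      Real.log_mul (by positivity) hwt.ne', Real.log_mul habs.ne' hwx.ne', log_weight,
      log_weight]
    · congr 1
      unfold residualField
      ring
    · have := chordal_log_nonneg h
      have := residualField_nonneg hs x
      have := residualField_nonneg hs t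
      positivity

/-- The mutual energy of two measures for the chordal kernel. -/
noncomputable def chordalEnergy (μ ν : Measure ℝ) : ENNReal :=
  ∫⁻ x, ∫⁻ t, chordalKernel x t ∂ν ∂μ

/-- As the energy kernel is nonnegative, the energy is a single integral with values in `[0, ∞]`. -/
lemma energy_weight {s : ℝ} (hs : 1 < s) (μ : Measure ℝ) [IsProbabilityMeasure μ] :
    energy (weight 1 s) μ = ((chordalEnergy μ μ +
      2 * ∫⁻ x, ENNReal.ofReal (residualField s x) ∂μ : ENNReal) : EReal) := by
  have hq : Measurable fun x => ENNReal.ofReal (residualField s x) :=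
    (continuous_residualField s).measurable.ennreal_ofReal
  have h1 : ∀ p : ℝ × ℝ, (energyKernel (weight 1 s) p.1 p.2).toENNReal =
      chordalKernel p.1 p.2 + ENNReal.ofReal (residualField s p.1) +
      ENNReal.ofReal (residualField s p.2) := fun p => by
    rw [energyKernel_weight hs, EReal.toENNReal_coe]
  have h2 : ∀ p : ℝ × ℝ, (-energyKernel (weight 1 s) p.1 p.2).toENNReal = 0 := fun p => by
    rw [energyKernel_weight hs, EReal.toENNReal_eq_zero_iff, EReal.neg_le, neg_zero]
    exact EReal.coe_ennreal_nonneg _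
  unfold energy extIntegral
  simp only [h1, h2, lintegral_zero, EReal.coe_ennreal_zero, sub_zero]
  congr 1
  have hq1 : Measurable fun p : ℝ × ℝ => ENNReal.ofReal (residualField s p.1) :=
    hq.comp measurable_fst
  have hq2 : Measurable fun p : ℝ × ℝ => ENNReal.ofReal (residualField s p.2) :=
    hq.comp measurable_snd
  rw [lintegral_add_right _ hq2, lintegral_add_right _ hq1,
    lintegral_prod _ measurable_chordalKernel.aemeasurable,
    lintegral_prod _ hq1.aemeasurable, lintegral_prod _ hq2.aemeasurable, chordalEnergy]
  simp only [lintegral_const, measure_univ, mul_one]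
  ring

/-! ### Positive definiteness of the chordal kernel -/

/-- The function `x ^ j / (1 + x ^ 2) ^ n`, bounded by `1` for `j ≤ 2 * n`; in terms of the angle
`arctan x` it is the trigonometric monomial `sin ^ j * cos ^ (2 * n - j)`. -/
noncomputable def rationalMonomial (n j : ℕ) (x : ℝ) : ℝ := x ^ j / (1 + x ^ 2) ^ n

/-- The integral of `rationalMonomial n j`, a generalised moment of `μ`. -/
noncomputable def rationalMoment (μ : Measure ℝ) (n j : ℕ) : ℝ := ∫ x, rationalMonomial n j x ∂μ

/-- The mutual energy of `μ` and `ν` for the kernel `cosSq ^ n`, as a diagonal form in the moments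
with positive coefficients; see `integral_integral_cosSq_pow`. -/
noncomputable def momentForm (μ ν : Measure ℝ) (n : ℕ) : ℝ :=
  ∑ j ∈ Finset.range (2 * n + 1),
    ((2 * n).choose j : ℝ) * (rationalMoment μ n j * rationalMoment ν n j)

lemma continuous_rationalMonomial (n j : ℕ) : Continuous (rationalMonomial n j) := by
  unfold rationalMonomial
  exact Continuous.div (by fun_prop) (by fun_prop) fun x => by positivity

lemma abs_rationalMonomial_le_one {n j : ℕ} (h : j ≤ 2 * n) (x : ℝ) :
    |rationalMonomial n j x| ≤ 1 := by
  have hpos : (0 : ℝ) < (1 + x ^ 2) ^ n := by positivity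
  rw [rationalMonomial, abs_div, abs_of_pos hpos, div_le_one hpos, abs_pow]
  rcases le_total |x| 1 with hx | hx
  · exact (pow_le_one₀ (abs_nonneg x) hx).trans (one_le_pow₀ (by nlinarith [sq_nonneg x]))
  · calc |x| ^ j ≤ |x| ^ (2 * n) := pow_le_pow_right₀ hx h
      _ = (x ^ 2) ^ n := by rw [pow_mul, sq_abs]
      _ ≤ (1 + x ^ 2) ^ n := by gcongr; linarith

lemma integrable_rationalMonomial (μ : Measure ℝ) [IsFiniteMeasure μ] {n j : ℕ} (h : j ≤ 2 * n) :
    Integrable (rationalMonomial n j) μ :=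
  Integrable.of_bound (continuous_rationalMonomial n j).aestronglyMeasurable 1
    (Filter.Eventually.of_forall fun x => abs_rationalMonomial_le_one h x)

/-- The binomial theorem separates the variables in `cosSq x t ^ n`. -/
lemma cosSq_pow (n : ℕ) (x t : ℝ) :
    cosSq x t ^ n = ∑ j ∈ Finset.range (2 * n + 1),
      ((2 * n).choose j : ℝ) * (rationalMonomial n j x * rationalMonomial n j t) := by
  rw [cosSq, div_pow, ← pow_mul, add_comm 1 (x * t), add_pow, mul_pow, Finset.sum_div]
  refine Finset.sum_congr rfl fun j _ => ?_
  rw [rationalMonomial, rationalMonomial, div_mul_div_comm, one_pow, mul_one, ← mul_pow, mul_comm,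
    mul_div_assoc, mul_pow x t]

lemma integral_integral_cosSq_pow (μ ν : Measure ℝ) [IsFiniteMeasure μ] [IsFiniteMeasure ν]
    (n : ℕ) :
    ∫ x, ∫ t, cosSq x t ^ n ∂ν ∂μ = momentForm μ ν n := by
  have hle : ∀ j ∈ Finset.range (2 * n + 1), j ≤ 2 * n := fun j hj =>
    Nat.lt_succ_iff.1 (Finset.mem_range.1 hj)
  have h1 : ∀ x, ∫ t, cosSq x t ^ n ∂ν = ∑ j ∈ Finset.range (2 * n + 1),
      ((2 * n).choose j : ℝ) * (rationalMonomial n j x * rationalMoment ν n j) := fun x => by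
    simp only [cosSq_pow]
    rw [integral_finsetSum _ fun j hj =>
      ((integrable_rationalMonomial ν (hle j hj)).const_mul _).const_mul _]
    simp only [integral_const_mul, rationalMoment]
  simp only [h1]
  rw [integral_finsetSum _ fun j hj =>
      ((integrable_rationalMonomial μ (hle j hj)).mul_const _).const_mul _]
  simp only [integral_const_mul, integral_mul_const, momentForm, rationalMoment]

lemma lintegral_lintegral_cosSq_pow (μ ν : Measure ℝ) [IsFiniteMeasure μ] [IsFiniteMeasure ν]
    (n : ℕ) {c : ℝ} (hc : 0 ≤ c) :
    ∫⁻ x, ∫⁻ t, ENNReal.ofReal (cosSq x t ^ n / c) ∂ν ∂μ =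
      ENNReal.ofReal (momentForm μ ν n / c) := by
  have hm : Measurable fun p : ℝ × ℝ => cosSq p.1 p.2 ^ n / c :=
    (measurable_cosSq.pow_const _).div_const _
  have hnn : ∀ x t, 0 ≤ cosSq x t ^ n / c := fun x t =>
    div_nonneg (pow_nonneg (cosSq_nonneg x t) n) hc
  have hle : ∀ x t, cosSq x t ^ n / c ≤ 1 / c := fun x t => by
    gcongr
    exact pow_le_one₀ (cosSq_nonneg x t) (cosSq_le_one x t)
  have hint : ∀ x, Integrable (fun t => cosSq x t ^ n / c) ν := fun x =>
    Integrable.of_bound (hm.comp measurable_prodMk_left).aestronglyMeasurable (1 / c)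
      (Filter.Eventually.of_forall fun t => by
        rw [Real.norm_of_nonneg (hnn x t)]; exact hle x t)
  have h1 : ∀ x, ∫⁻ t, ENNReal.ofReal (cosSq x t ^ n / c) ∂ν =
      ENNReal.ofReal (∫ t, cosSq x t ^ n / c ∂ν) := fun x =>
    (ofReal_integral_eq_lintegral_ofReal (hint x)
      (Filter.Eventually.of_forall (hnn x))).symm
  have hint2 : Integrable (fun x => ∫ t, cosSq x t ^ n / c ∂ν) μ := by
    have : Integrable (fun p : ℝ × ℝ => cosSq p.1 p.2 ^ n / c) (μ.prod ν) :=
      Integrable.of_bound hm.aestronglyMeasurable (1 / c)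
        (Filter.Eventually.of_forall fun p => by
          rw [Real.norm_of_nonneg (hnn p.1 p.2)]; exact hle p.1 p.2)
    exact this.integral_prod_left
  simp only [h1]
  rw [← ofReal_integral_eq_lintegral_ofReal hint2
    (Filter.Eventually.of_forall fun x => integral_nonneg (hnn x))]
  simp only [integral_div, integral_integral_cosSq_pow]

/-- All terms are nonnegative, so Tonelli's theorem applies without any condition on the energy. -/
lemma chordalEnergy_eq_tsum (μ ν : Measure ℝ) [IsFiniteMeasure μ] [IsFiniteMeasure ν] :
    chordalEnergy μ ν =
      ∑' n : ℕ, ENNReal.ofReal (momentForm μ ν (n + 1) / (2 * (n + 1))) := by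
  have hm : ∀ n : ℕ, Measurable fun p : ℝ × ℝ =>
      ENNReal.ofReal (cosSq p.1 p.2 ^ (n + 1) / (2 * (n + 1))) := fun n =>
    ((measurable_cosSq.pow_const _).div_const _).ennreal_ofReal
  unfold chordalEnergy chordalKernel
  have h1 : ∀ x, ∫⁻ t, ∑' n : ℕ, ENNReal.ofReal (cosSq x t ^ (n + 1) / (2 * (n + 1))) ∂ν =
      ∑' n : ℕ, ∫⁻ t, ENNReal.ofReal (cosSq x t ^ (n + 1) / (2 * (n + 1))) ∂ν := fun x =>
    lintegral_tsum fun n => ((hm n).comp measurable_prodMk_left).aemeasurable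
  simp only [h1]
  rw [lintegral_tsum fun n => (hm n).lintegral_prod_right'.aemeasurable]
  refine tsum_congr fun n => ?_
  exact lintegral_lintegral_cosSq_pow μ ν (n + 1) (by positivity)

lemma momentForm_nonneg (μ ν : Measure ℝ) [IsFiniteMeasure μ] [IsFiniteMeasure ν] (n : ℕ) :
    0 ≤ momentForm μ ν n := by
  rw [← integral_integral_cosSq_pow]
  exact integral_nonneg fun x => integral_nonneg fun t => pow_nonneg (cosSq_nonneg x t) n

lemma momentForm_sub (μ ν : Measure ℝ) (n : ℕ) :
    momentForm μ μ n + momentForm ν ν n - 2 * momentForm μ ν n =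
      ∑ j ∈ Finset.range (2 * n + 1),
        ((2 * n).choose j : ℝ) * (rationalMoment μ n j - rationalMoment ν n j) ^ 2 := by
  unfold momentForm
  rw [Finset.mul_sum, ← Finset.sum_add_distrib, ← Finset.sum_sub_distrib]
  exact Finset.sum_congr rfl fun j _ => by ring

lemma two_mul_momentForm_le (μ ν : Measure ℝ) (n : ℕ) :
    2 * momentForm μ ν n ≤ momentForm μ μ n + momentForm ν ν n := by
  have h := momentForm_sub μ ν n
  have : 0 ≤ ∑ j ∈ Finset.range (2 * n + 1),
        ((2 * n).choose j : ℝ) * (rationalMoment μ n j - rationalMoment ν n j) ^ 2 :=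
    Finset.sum_nonneg fun j _ => by positivity
  linarith

lemma chordalEnergy_add (μ ν : Measure ℝ) [IsFiniteMeasure μ] [IsFiniteMeasure ν] :
    chordalEnergy μ μ + chordalEnergy ν ν = ∑' n : ℕ, ENNReal.ofReal
      ((momentForm μ μ (n + 1) + momentForm ν ν (n + 1)) / (2 * (n + 1))) := by
  rw [chordalEnergy_eq_tsum, chordalEnergy_eq_tsum, ← ENNReal.tsum_add]
  refine tsum_congr fun n => ?_
  have h1 := momentForm_nonneg μ μ (n + 1)
  have h2 := momentForm_nonneg ν ν (n + 1)
  rw [← ENNReal.ofReal_add (by positivity) (by positivity), add_div]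

lemma two_mul_chordalEnergy (μ ν : Measure ℝ) [IsFiniteMeasure μ] [IsFiniteMeasure ν] :
    2 * chordalEnergy μ ν = ∑' n : ℕ, ENNReal.ofReal
      ((2 * momentForm μ ν (n + 1)) / (2 * (n + 1))) := by
  rw [chordalEnergy_eq_tsum, ← ENNReal.tsum_mul_left]
  refine tsum_congr fun n => ?_
  rw [mul_div_assoc, ENNReal.ofReal_mul zero_le_two, ENNReal.ofReal_ofNat]

/-- Positive definiteness of the chordal kernel, in a form without differences of infinite
energies. -/
lemma two_mul_chordalEnergy_le (μ ν : Measure ℝ) [IsFiniteMeasure μ] [IsFiniteMeasure ν] :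
    2 * chordalEnergy μ ν ≤ chordalEnergy μ μ + chordalEnergy ν ν := by
  rw [chordalEnergy_add, two_mul_chordalEnergy]
  refine ENNReal.tsum_le_tsum fun n => ENNReal.ofReal_le_ofReal ?_
  have := two_mul_momentForm_le μ ν (n + 1)
  gcongr

/-- Equality in `two_mul_chordalEnergy_le` forces equality in each term of the series. -/
lemma rationalMoment_eq_of_chordalEnergy_eq {μ ν : Measure ℝ} [IsFiniteMeasure μ]
    [IsFiniteMeasure ν] (hfin : chordalEnergy μ ν ≠ ⊤)
    (h : chordalEnergy μ μ + chordalEnergy ν ν ≤ 2 * chordalEnergy μ ν) {n j : ℕ}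
    (hn : n ≠ 0) (hj : j ≤ 2 * n) : rationalMoment μ n j = rationalMoment ν n j := by
  obtain ⟨k, rfl⟩ := Nat.exists_eq_succ_of_ne_zero hn
  by_contra hne
  refine absurd h (not_le.2 ?_)
  have hpos : 0 < ∑ j ∈ Finset.range (2 * k.succ + 1),
      ((2 * k.succ).choose j : ℝ) *
        (rationalMoment μ k.succ j - rationalMoment ν k.succ j) ^ 2 := by
    refine Finset.sum_pos' (fun i _ => by positivity)
      ⟨j, Finset.mem_range.2 (Nat.lt_succ_iff.2 hj), ?_⟩
    have h1 : 0 < (2 * k.succ).choose j := Nat.choose_pos hj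
    have h2 := sub_ne_zero.2 hne
    positivity
  rw [← momentForm_sub] at hpos
  have htop : 2 * chordalEnergy μ ν ≠ ⊤ := ENNReal.mul_ne_top (by simp) hfin
  rw [two_mul_chordalEnergy] at htop
  rw [chordalEnergy_add, two_mul_chordalEnergy]
  refine ENNReal.tsum_lt_tsum (i := k) htop (fun i => ENNReal.ofReal_le_ofReal ?_) ?_
  · have := two_mul_momentForm_le μ ν (i + 1)
    gcongr
  · rw [Nat.succ_eq_add_one] at hpos
    have h1 := momentForm_nonneg μ ν (k + 1)
    refine (ENNReal.ofReal_lt_ofReal_iff ?_).2 ?_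
    · exact div_pos (by linarith) (by positivity)
    · gcongr
      linarith

/-- The algebra of the bounded functions `p x / (1 + x ^ 2) ^ n` with `p` a polynomial of degree at
most `2 * n`. -/
noncomputable def rationalSubalgebra :
    StarSubalgebra ℝ (BoundedContinuousFunction ℝ ℝ) where
  carrier := {g | ∃ (n : ℕ) (p : Polynomial ℝ), p.natDegree ≤ 2 * n ∧
    ∀ x, g x = p.eval x / (1 + x ^ 2) ^ n}
  mul_mem' := by
    rintro f g ⟨n, p, hp, hf⟩ ⟨m, q, hq, hg⟩
    refine ⟨n + m, p * q, Polynomial.natDegree_mul_le.trans (by omega), fun x => ?_⟩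
    rw [BoundedContinuousFunction.mul_apply, hf, hg, Polynomial.eval_mul, pow_add,
      div_mul_div_comm]
  add_mem' := by
    rintro f g ⟨n, p, hp, hf⟩ ⟨m, q, hq, hg⟩
    have hX : ∀ k : ℕ, ((1 + Polynomial.X ^ 2 : Polynomial ℝ) ^ k).natDegree ≤ 2 * k := fun k => by
      refine Polynomial.natDegree_pow_le.trans ?_
      rw [mul_comm]
      gcongr
      compute_degree
    refine ⟨n + m, p * (1 + Polynomial.X ^ 2) ^ m + q * (1 + Polynomial.X ^ 2) ^ n, ?_,
      fun x => ?_⟩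
    · refine Polynomial.natDegree_add_le_of_degree_le
        (Polynomial.natDegree_mul_le.trans ?_) (Polynomial.natDegree_mul_le.trans ?_)
      · have := hX m
        omega
      · have := hX n
        omega
    · have h : (1 + x ^ 2) ≠ 0 := by positivity
      rw [BoundedContinuousFunction.add_apply, hf, hg]
      simp only [Polynomial.eval_add, Polynomial.eval_mul, Polynomial.eval_pow, Polynomial.eval_one,
        Polynomial.eval_X]
      rw [div_add_div _ _ (pow_ne_zero _ h) (pow_ne_zero _ h), pow_add]
      ring
  algebraMap_mem' := fun r => ⟨0, Polynomial.C r, by simp, fun x => by simp⟩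
  star_mem' := by
    rintro f ⟨n, p, hp, hf⟩
    exact ⟨n, p, hp, fun x => by simpa using hf x⟩

/-- `rationalMonomial n j` as a bounded continuous function. -/
noncomputable def boundedRationalMonomial {n j : ℕ} (h : j ≤ 2 * n) :
    BoundedContinuousFunction ℝ ℝ :=
  BoundedContinuousFunction.ofNormedAddCommGroup (rationalMonomial n j)
    (continuous_rationalMonomial n j) 1 (abs_rationalMonomial_le_one h)

lemma boundedRationalMonomial_mem {n j : ℕ} (h : j ≤ 2 * n) :
    boundedRationalMonomial h ∈ rationalSubalgebra :=
  ⟨n, Polynomial.X ^ j, by simpa using h, fun x => by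
    simp [boundedRationalMonomial, rationalMonomial]⟩

/-- The functions `x / (1 + x ^ 2)` and `1 / (1 + x ^ 2)` together separate the points of the line,
so the moments determine a finite measure. -/
lemma ext_of_rationalMoment_eq {μ ν : Measure ℝ} [IsFiniteMeasure μ] [IsFiniteMeasure ν]
    (h : ∀ n j, j ≤ 2 * n → rationalMoment μ n j = rationalMoment ν n j) : μ = ν := by
  refine ext_of_forall_mem_subalgebra_integral_eq_of_polish (𝕜 := ℝ) (A := rationalSubalgebra)
    ?_ ?_
  · intro x y hxy
    by_contra hcon
    have key : ∀ j, j ≤ 2 * 1 → rationalMonomial 1 j x = rationalMonomial 1 j y := fun j hj => by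
      by_contra hne
      exact hcon ⟨_, ⟨_, ⟨_, boundedRationalMonomial_mem hj, rfl⟩, rfl⟩, hne⟩
    have h0 := key 0 (by norm_num)
    have h1 := key 1 (by norm_num)
    have hx : 0 < 1 + x ^ 2 := by positivity
    have hy : 0 < 1 + y ^ 2 := by positivity
    simp only [rationalMonomial, pow_zero, pow_one] at h0 h1
    rw [div_eq_div_iff hx.ne' hy.ne'] at h0 h1
    rw [one_mul, one_mul] at h0
    rw [h0] at h1
    exact hxy (mul_right_cancel₀ hx.ne' h1)
  · rintro g ⟨n, p, hp, hg⟩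
    have hsum : ∀ (ρ : Measure ℝ) [IsFiniteMeasure ρ], ∫ x, g x ∂ρ =
        ∑ j ∈ Finset.range (2 * n + 1), p.coeff j * rationalMoment ρ n j := fun ρ _ => by
      have : ∀ x, g x = ∑ j ∈ Finset.range (2 * n + 1), p.coeff j * rationalMonomial n j x :=
        fun x => by
          rw [hg, Polynomial.eval_eq_sum_range' (Nat.lt_succ_iff.2 hp), Finset.sum_div]
          exact Finset.sum_congr rfl fun j _ => by rw [rationalMonomial, mul_div_assoc]
      simp only [this]
      rw [integral_finsetSum _ fun j hj => (integrable_rationalMonomial ρ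
        (Nat.lt_succ_iff.1 (Finset.mem_range.1 hj))).const_mul _]
      simp only [integral_const_mul, rationalMoment]
    rw [hsum μ, hsum ν]
    exact Finset.sum_congr rfl fun j hj => by
      rw [h n j (Nat.lt_succ_iff.1 (Finset.mem_range.1 hj))]

/-- Strict positive definiteness of the chordal kernel on probability measures. -/
lemma eq_of_chordalEnergy_add_le {μ ν : Measure ℝ} [IsProbabilityMeasure μ]
    [IsProbabilityMeasure ν] (hfin : chordalEnergy μ ν ≠ ⊤)
    (h : chordalEnergy μ μ + chordalEnergy ν ν ≤ 2 * chordalEnergy μ ν) : μ = ν := by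
  refine ext_of_rationalMoment_eq fun n j hj => ?_
  rcases eq_or_ne n 0 with rfl | hn
  · obtain rfl : j = 0 := by omega
    simp [rationalMoment, rationalMonomial]
  · exact rationalMoment_eq_of_chordalEnergy_eq hfin h hn hj

/-! ### Frostman inequalities characterise the minimizer -/

lemma chordalEnergy_self_add {s F : ℝ} {ν : Measure ℝ} [IsProbabilityMeasure ν]
    (heq : ∀ᵐ x ∂ν, ∫⁻ t, chordalKernel x t ∂ν +
      ENNReal.ofReal (residualField s x) = ENNReal.ofReal F) :
    chordalEnergy ν ν + ∫⁻ x, ENNReal.ofReal (residualField s x) ∂ν = ENNReal.ofReal F := by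
  have hq : Measurable fun x => ENNReal.ofReal (residualField s x) :=
    (continuous_residualField s).measurable.ennreal_ofReal
  rw [chordalEnergy, ← lintegral_add_right _ hq, lintegral_congr_ae heq]
  simp

lemma le_chordalEnergy_add {s F : ℝ} {ν : Measure ℝ}
    (hle : ∀ x, ENNReal.ofReal F ≤ ∫⁻ t, chordalKernel x t ∂ν +
      ENNReal.ofReal (residualField s x)) (μ : Measure ℝ) [IsProbabilityMeasure μ] :
    ENNReal.ofReal F ≤ chordalEnergy μ ν + ∫⁻ x, ENNReal.ofReal (residualField s x) ∂μ := by
  have hq : Measurable fun x => ENNReal.ofReal (residualField s x) :=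
    (continuous_residualField s).measurable.ennreal_ofReal
  rw [chordalEnergy, ← lintegral_add_right _ hq]
  calc ENNReal.ofReal F = ∫⁻ _, ENNReal.ofReal F ∂μ := by simp
    _ ≤ _ := lintegral_mono hle

/-- A probability measure whose potential in the field is the constant `F` almost everywhere for
itself, and at least `F` everywhere, minimizes the energy, and it is the only minimizer. With
`K μ = ∫ q dμ`, this is
`H(μ, μ) + H(ν, ν) + 2 * K μ ≥ 2 * (H(μ, ν) + K μ) ≥ 2 * F = 2 * (H(ν, ν) + K ν)`,
and `H(ν, ν) ≤ F` is finite and can be cancelled. -/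
lemma frostman_minimal {s F : ℝ} {ν : Measure ℝ} [IsProbabilityMeasure ν]
    (hle : ∀ x, ENNReal.ofReal F ≤ ∫⁻ t, chordalKernel x t ∂ν +
      ENNReal.ofReal (residualField s x))
    (heq : ∀ᵐ x ∂ν, ∫⁻ t, chordalKernel x t ∂ν +
      ENNReal.ofReal (residualField s x) = ENNReal.ofReal F)
    (μ : Measure ℝ) [IsProbabilityMeasure μ] :
    chordalEnergy ν ν + 2 * ∫⁻ x, ENNReal.ofReal (residualField s x) ∂ν ≤
      chordalEnergy μ μ + 2 * ∫⁻ x, ENNReal.ofReal (residualField s x) ∂μ ∧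
    (chordalEnergy μ μ + 2 * ∫⁻ x, ENNReal.ofReal (residualField s x) ∂μ ≤
      chordalEnergy ν ν + 2 * ∫⁻ x, ENNReal.ofReal (residualField s x) ∂ν → μ = ν) := by
  have h1 := chordalEnergy_self_add heq
  have h2 := le_chordalEnergy_add hle μ
  have h3 := two_mul_chordalEnergy_le μ ν
  have h4 := eq_of_chordalEnergy_add_le (μ := μ) (ν := ν)
  rw [← h1] at h2
  have hfin : chordalEnergy ν ν + ∫⁻ x, ENNReal.ofReal (residualField s x) ∂ν ≠ ⊤ := by
    rw [h1]; exact ENNReal.ofReal_ne_top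
  generalize chordalEnergy μ μ = a at *
  generalize chordalEnergy ν ν = b at *
  generalize chordalEnergy μ ν = c at *
  generalize ∫⁻ x, ENNReal.ofReal (residualField s x) ∂μ = m at *
  generalize ∫⁻ x, ENNReal.ofReal (residualField s x) ∂ν = k at *
  obtain ⟨hb, hk⟩ := ENNReal.add_ne_top.1 hfin
  -- Only `ν` is known to have finite energy; for the other measure the infinite cases are trivial.
  lift b to NNReal using hb
  lift k to NNReal using hk
  rcases eq_or_ne a ⊤ with rfl | ha
  · simp [ENNReal.mul_eq_top]
  rcases eq_or_ne m ⊤ with rfl | hm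
  · simp [ENNReal.mul_eq_top]
  lift a to NNReal using ha
  lift m to NNReal using hm
  have hc : c ≠ ⊤ := fun h => by
    rw [h, ENNReal.mul_top two_ne_zero, top_le_iff] at h3
    exact ENNReal.add_ne_top.2 ⟨ENNReal.coe_ne_top, ENNReal.coe_ne_top⟩ h3
  lift c to NNReal using hc
  norm_cast at h2 h3
  refine ⟨?_, fun h => h4 ENNReal.coe_ne_top ?_⟩
  · norm_cast
    rw [← NNReal.coe_le_coe] at *
    push_cast at *
    linarith
  · norm_cast at h ⊢
    rw [← NNReal.coe_le_coe] at *
    push_cast at *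
    linarith

/-! ### Poisson integrals of the logarithm on the unit circle -/

lemma continuousOn_poissonKernel {w : ℂ} (hw : ‖w‖ < 1) :
    ContinuousOn (poissonKernel 0 w) (Metric.sphere 0 |1|) := by
  rw [poissonKernel_eq_re_herglotzRieszKernel]
  exact Complex.continuous_re.comp_continuousOn
    (continuousOn_herglotzRieszKernel_sphere (by simpa using hw))

lemma circleIntegrable_mul_log_norm_sub {g : ℂ → ℝ} (hg : ContinuousOn g (Metric.sphere 0 |1|))
    (u : ℂ) : CircleIntegrable (fun z => g z * Real.log ‖z - u‖) 0 1 :=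
  (circleIntegrable_log_norm_sub_const (a := u) 1).continuousOn_smul hg

/-- Poisson's formula for `log ‖z - u‖`, with the singularity `u` outside the open unit disc,
possibly on the circle. -/
lemma circleAverage_poissonKernel_mul_log {w u : ℂ} (hw : ‖w‖ < 1) (hu : 1 ≤ ‖u‖) :
    Real.circleAverage (fun z => poissonKernel 0 w z * Real.log ‖z - u‖) 0 1 =
      Real.log ‖w - u‖ := by
  have hw' : w ∈ Metric.ball (0 : ℂ) 1 := by simpa using hw
  rcases hu.eq_or_lt with h | h
  · have := circleAverage_re_herglotzRieszKernel_mul_log (c := 0) (R := 1) (ρ := u) (w := w)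
      (by simpa using h.symm) hw'
    rw [← poissonKernel_eq_re_herglotzRieszKernel] at this
    exact this
  · refine InnerProductSpace.HarmonicOnNhd.circleAverage_poissonKernel_smul
      (f := fun z => Real.log ‖z - u‖) (fun z hz => ?_) hw'
    refine AnalyticAt.harmonicAt_log_norm (by fun_prop) (sub_ne_zero.2 ?_)
    rintro rfl
    have : ‖z‖ ≤ 1 := by simpa using hz
    linarith

lemma circleAverage_poissonKernel {w : ℂ} (hw : ‖w‖ < 1) :
    Real.circleAverage (poissonKernel 0 w) 0 1 = 1 := by
  have h := InnerProductSpace.HarmonicOnNhd.circleAverage_poissonKernel_smul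
    (f := fun _ => (1 : ℝ)) (c := 0) (R := 1) (w := w)
    (fun z _ => InnerProductSpace.harmonicAt_const _) (by simpa using hw)
  rw [← h]
  congr 1
  ext z
  simp

/-- The density `s * P - (s - 1)` on the unit circle, where `P` is the mean of the Poisson kernels at
the points `± i √(1 / (2 * s - 1))`. -/
noncomputable def arcKernel (s : ℝ) (z : ℂ) : ℝ :=
  s * ((poissonKernel 0 (Complex.I * √(1 / (2 * s - 1))) z +
    poissonKernel 0 (-(Complex.I * √(1 / (2 * s - 1)))) z) / 2) - (s - 1)

/-- The values of `arcKernel s` on the unit circle in terms of the angle, see `arcKernel_circleMap`. -/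
noncomputable def arcDensity (s θ : ℝ) : ℝ :=
  (s - 1) * (2 * s - 1) * Real.sin θ ^ 2 / (s ^ 2 - (2 * s - 1) * Real.sin θ ^ 2)

lemma norm_pole_lt_one {s : ℝ} (hs : 1 < s) :
    ‖Complex.I * (√(1 / (2 * s - 1)) : ℂ)‖ < 1 := by
  have h : 1 / (2 * s - 1) < 1 := by rw [div_lt_one (by linarith)]; linarith
  rw [norm_mul, Complex.norm_I, one_mul, Complex.norm_real, Real.norm_of_nonneg (by positivity)]
  rw [Real.sqrt_lt' one_pos]
  simpa using h

lemma norm_circleMap_sub_I_mul_sq (b θ : ℝ) :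
    ‖circleMap 0 1 θ - Complex.I * b‖ ^ 2 = 1 + b ^ 2 - 2 * b * Real.sin θ := by
  rw [← Complex.normSq_eq_norm_sq, Complex.normSq_apply]
  simp [circleMap, Complex.exp_re, Complex.exp_im]
  nlinarith [Real.sin_sq_add_cos_sq θ]

lemma arcDensity_denom_pos {s : ℝ} (hs : 1 < s) (θ : ℝ) :
    0 < s ^ 2 - (2 * s - 1) * Real.sin θ ^ 2 := by
  have h1 := Real.sin_sq_le_one θ
  nlinarith

lemma poissonKernel_I_mul (b θ : ℝ) :
    poissonKernel 0 (Complex.I * b) (circleMap 0 1 θ) =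
      (1 - b ^ 2) / (1 + b ^ 2 - 2 * b * Real.sin θ) := by
  rw [poissonKernel_def, sub_zero, sub_zero, norm_circleMap_sub_I_mul_sq]
  simp

lemma arcKernel_circleMap {s : ℝ} (hs : 1 < s) (θ : ℝ) :
    arcKernel s (circleMap 0 1 θ) = arcDensity s θ := by
  have hm : 0 < 2 * s - 1 := by linarith
  have hneg : -(Complex.I * (√(1 / (2 * s - 1)) : ℂ)) =
      Complex.I * ((-√(1 / (2 * s - 1)) : ℝ) : ℂ) := by push_cast; ring
  have hr0 : 0 ≤ √(1 / (2 * s - 1)) := Real.sqrt_nonneg _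
  have hr2 : √(1 / (2 * s - 1)) ^ 2 = 1 / (2 * s - 1) := Real.sq_sqrt (by positivity)
  have hr1 : √(1 / (2 * s - 1)) < 1 := by
    rw [Real.sqrt_lt' one_pos, div_lt_iff₀ hm]; linarith
  rw [arcKernel, hneg, poissonKernel_I_mul, poissonKernel_I_mul, arcDensity]
  have hD := arcDensity_denom_pos hs θ
  generalize √(1 / (2 * s - 1)) = r at *
  have hs1 := Real.neg_one_le_sin θ
  have hs2 := Real.sin_le_one θ
  generalize Real.sin θ = y at *
  have hd1 : 0 < 1 + r ^ 2 - 2 * r * y := by nlinarith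
  have hd2 : 0 < 1 + (-r) ^ 2 - 2 * -r * y := by nlinarith
  have hprod : (1 + r ^ 2 - 2 * r * y) * (1 + (-r) ^ 2 - 2 * -r * y) =
      4 * (s ^ 2 - (2 * s - 1) * y ^ 2) / (2 * s - 1) ^ 2 := by
    have : (1 + r ^ 2 - 2 * r * y) * (1 + (-r) ^ 2 - 2 * -r * y) =
      (1 + r ^ 2) ^ 2 - 4 * r ^ 2 * y ^ 2 := by ring
    rw [this, hr2]
    field_simp
    ring
  have hnum : (1 - r ^ 2) * (1 + (-r) ^ 2 - 2 * -r * y) +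
      (1 + r ^ 2 - 2 * r * y) * (1 - (-r) ^ 2) = 8 * s * (s - 1) / (2 * s - 1) ^ 2 := by
    have : (1 - r ^ 2) * (1 + (-r) ^ 2 - 2 * -r * y) +
      (1 + r ^ 2 - 2 * r * y) * (1 - (-r) ^ 2) = 2 * (1 - r ^ 2) * (1 + r ^ 2) := by ring
    rw [this, hr2]
    field_simp
    ring
  rw [div_add_div _ _ hd1.ne' hd2.ne', hprod, hnum,
    div_div_div_cancel_right₀ (pow_ne_zero 2 hm.ne')]
  generalize hE : s ^ 2 - (2 * s - 1) * y ^ 2 = E at *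
  field_simp
  rw [← hE]
  ring

lemma continuousOn_arcKernel {s : ℝ} (hs : 1 < s) :
    ContinuousOn (arcKernel s) (Metric.sphere 0 |1|) := by
  have h1 := continuousOn_poissonKernel (norm_pole_lt_one hs)
  have h2 := continuousOn_poissonKernel (norm_neg (Complex.I * (√(1 / (2 * s - 1)) : ℂ)) ▸
    norm_pole_lt_one hs)
  unfold arcKernel
  fun_prop

lemma circleAverage_arcKernel {s : ℝ} (hs : 1 < s) :
    Real.circleAverage (arcKernel s) 0 1 = 1 := by
  have hw := norm_pole_lt_one hs
  have hw' := norm_neg (Complex.I * (√(1 / (2 * s - 1)) : ℂ)) ▸ hw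
  have i1 := (continuousOn_poissonKernel hw).circleIntegrable'
  have i2 := (continuousOn_poissonKernel hw').circleIntegrable'
  have h1 := circleAverage_poissonKernel hw
  have h2 := circleAverage_poissonKernel hw'
  have : arcKernel s = (s / 2) • (poissonKernel 0 (Complex.I * (√(1 / (2 * s - 1)) : ℂ)) +
      poissonKernel 0 (-(Complex.I * (√(1 / (2 * s - 1)) : ℂ)))) - fun _ => s - 1 := by
    ext z
    simp [arcKernel]
    ring
  rw [this, Real.circleAverage_sub ((i1.add i2).const_smul) (circleIntegrable_const _ _ _),
    Real.circleAverage_smul, Real.circleAverage_add i1 i2, h1, h2, Real.circleAverage_const]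
  simp
  ring

/-- The two poles `± w` contribute `‖w - u‖ * ‖-w - u‖ = ‖u ^ 2 - w ^ 2‖`, and
`w ^ 2 = -1 / (2 * s - 1)`. -/
lemma circleAverage_arcKernel_mul_log {s : ℝ} (hs : 1 < s) {u : ℂ} (hu : 1 ≤ ‖u‖) :
    Real.circleAverage (fun z => arcKernel s z * Real.log ‖z - u‖) 0 1 =
      s / 2 * Real.log ‖u ^ 2 + ((1 / (2 * s - 1) : ℝ) : ℂ)‖ - (s - 1) * Real.log ‖u‖ := by
  have hw := norm_pole_lt_one hs
  have hw' := norm_neg (Complex.I * (√(1 / (2 * s - 1)) : ℂ)) ▸ hw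
  have i1 := circleIntegrable_mul_log_norm_sub (continuousOn_poissonKernel hw) u
  have i2 := circleIntegrable_mul_log_norm_sub (continuousOn_poissonKernel hw') u
  have i3 := circleIntegrable_log_norm_sub_const (c := 0) (a := u) 1
  have h1 := circleAverage_poissonKernel_mul_log hw hu
  have h2 := circleAverage_poissonKernel_mul_log hw' hu
  have h3 : Real.circleAverage (Real.log ‖· - u‖) 0 1 = Real.log ‖u‖ := by
    rw [circleAverage_log_norm_sub_const_eq_posLog, Real.posLog_eq_log]
    simpa using hu
  have hsq : (Complex.I * (√(1 / (2 * s - 1)) : ℂ)) ^ 2 = -((1 / (2 * s - 1) : ℝ) : ℂ) := by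
    have hm : 0 < 2 * s - 1 := by linarith
    rw [mul_pow, Complex.I_sq, ← Complex.ofReal_pow, Real.sq_sqrt (by positivity)]
    ring
  generalize hwdef : Complex.I * (√(1 / (2 * s - 1)) : ℂ) = w at *
  have hne : ∀ v : ℂ, ‖v‖ < 1 → ‖v - u‖ ≠ 0 := fun v hv h => by
    rw [norm_eq_zero, sub_eq_zero] at h
    rw [h] at hv
    linarith
  have hfac : ‖u ^ 2 + ((1 / (2 * s - 1) : ℝ) : ℂ)‖ = ‖w - u‖ * ‖-w - u‖ := by
    rw [← norm_mul]
    congr 1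
    linear_combination hsq
  have : (fun z => arcKernel s z * Real.log ‖z - u‖) =
      (s / 2) • ((fun z => poissonKernel 0 w z * Real.log ‖z - u‖) +
        fun z => poissonKernel 0 (-w) z * Real.log ‖z - u‖) -
      (s - 1) • (Real.log ‖· - u‖) := by
    ext z
    simp only [arcKernel, hwdef, Pi.sub_apply, Pi.smul_apply, Pi.add_apply, smul_eq_mul]
    ring
  rw [this, Real.circleAverage_sub ((i1.add i2).const_smul) i3.const_smul,
    Real.circleAverage_smul, Real.circleAverage_smul, Real.circleAverage_add i1 i2, h1, h2, h3,
    hfac, Real.log_mul (hne w hw) (hne (-w) hw')]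
  simp

/-! ### The candidate measure and its logarithmic potential -/

/-- The right end point of the support of the equilibrium measure. -/
noncomputable def supportRadius (s : ℝ) : ℝ := √(2 * s - 1) / (s - 1)

/-- The density of the equilibrium measure on its support. Outside the support the radicand is
negative, and the square root takes the value `0`. -/
noncomputable def equilibriumDensity (s x : ℝ) : ℝ :=
  √(2 * s - 1 - (s - 1) ^ 2 * x ^ 2) / (Real.pi * (1 + x ^ 2))

/-- The measure on `[-supportRadius s, supportRadius s]` with density `equilibriumDensity s`. -/
noncomputable def equilibriumMeasure (s : ℝ) : Measure ℝ :=
  (volume.restrict (Set.Icc (-supportRadius s) (supportRadius s))).withDensity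
    fun x => ENNReal.ofReal (equilibriumDensity s x)

lemma supportRadius_pos {s : ℝ} (hs : 1 < s) : 0 < supportRadius s :=
  div_pos (Real.sqrt_pos.2 (by linarith)) (by linarith)

lemma supportRadius_sq {s : ℝ} (hs : 1 < s) :
    supportRadius s ^ 2 = (2 * s - 1) / (s - 1) ^ 2 := by
  rw [supportRadius, div_pow, Real.sq_sqrt (by linarith)]

lemma equilibriumDensity_nonneg (s x : ℝ) : 0 ≤ equilibriumDensity s x := by
  unfold equilibriumDensity
  have := Real.pi_pos
  positivity

lemma continuous_equilibriumDensity (s : ℝ) : Continuous (equilibriumDensity s) := by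
  unfold equilibriumDensity
  refine Continuous.div (by fun_prop) (by fun_prop) fun x => ?_
  have := Real.pi_pos
  positivity

lemma image_supportRadius_mul_cos {s : ℝ} (hs : 1 < s) :
    (fun θ => supportRadius s * Real.cos θ) '' Set.Icc 0 Real.pi =
      Set.Icc (-supportRadius s) (supportRadius s) := by
  have h := Real.bijOn_cos.image_eq
  have : (fun θ => supportRadius s * Real.cos θ) '' Set.Icc 0 Real.pi =
      (fun y => supportRadius s * y) '' (Real.cos '' Set.Icc 0 Real.pi) := by
    rw [Set.image_image]
  rw [this, h, Set.image_mul_left_Icc (supportRadius_pos hs).le (by norm_num)]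
  simp

/-- The substitution `x = supportRadius s * cos θ` turns `equilibriumDensity s x dx` into
`arcDensity s θ dθ / π`. -/
lemma abs_deriv_mul_equilibriumDensity {s θ : ℝ} (hs : 1 < s) (hθ : θ ∈ Set.Icc 0 Real.pi) :
    |supportRadius s * -Real.sin θ| * equilibriumDensity s (supportRadius s * Real.cos θ) =
      Real.pi⁻¹ * arcDensity s θ := by
  have hsin := Real.sin_nonneg_of_mem_Icc hθ
  have hs1 : s - 1 ≠ 0 := by linarith
  have hm : 0 ≤ 2 * s - 1 := by linarith
  have hD := arcDensity_denom_pos hs θ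
  have h1 : 2 * s - 1 - (s - 1) ^ 2 * (supportRadius s * Real.cos θ) ^ 2 =
      (2 * s - 1) * Real.sin θ ^ 2 := by
    rw [mul_pow, supportRadius_sq hs, Real.cos_sq']
    field_simp
    ring
  have h2 : 1 + (supportRadius s * Real.cos θ) ^ 2 =
      (s ^ 2 - (2 * s - 1) * Real.sin θ ^ 2) / (s - 1) ^ 2 := by
    rw [mul_pow, supportRadius_sq hs, Real.cos_sq']
    field_simp
    ring
  rw [mul_neg, abs_neg, abs_of_nonneg (mul_nonneg (supportRadius_pos hs).le hsin),
    equilibriumDensity, h1, h2, Real.sqrt_mul hm, Real.sqrt_sq hsin, arcDensity, supportRadius]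
  have hpi := Real.pi_ne_zero
  field_simp
  rw [Real.sq_sqrt hm]

lemma arcDensity_comp_reflect (s θ : ℝ) : arcDensity s (2 * Real.pi - θ) = arcDensity s θ := by
  simp [arcDensity, Real.sin_two_pi_sub]

/-- Integrals against the candidate measure are averages over the whole circle: the upper half is
parametrised by `x = supportRadius s * cos θ`, and the lower half contributes the same amount. -/
lemma integrable_equilibriumMeasure {s : ℝ} (hs : 1 < s) {f : ℝ → ℝ}
    (hf : IntervalIntegrable (fun θ => arcDensity s θ * f (supportRadius s * Real.cos θ))
      volume 0 (2 * Real.pi)) :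
    Integrable f (equilibriumMeasure s) ∧ ∫ x, f x ∂equilibriumMeasure s =
      (2 * Real.pi)⁻¹ * ∫ θ in 0..(2 * Real.pi),
        arcDensity s θ * f (supportRadius s * Real.cos θ) := by
  have hpi := Real.pi_pos
  have hmeas : Measurable fun x => ENNReal.ofReal (equilibriumDensity s x) :=
    (continuous_equilibriumDensity s).measurable.ennreal_ofReal
  have hfin : ∀ᵐ x ∂volume.restrict (Set.Icc (-supportRadius s) (supportRadius s)),
      ENNReal.ofReal (equilibriumDensity s x) < ⊤ :=
    Filter.Eventually.of_forall fun x => ENNReal.ofReal_lt_top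
  have hderiv : ∀ θ ∈ Set.Icc 0 Real.pi, HasDerivWithinAt (fun θ => supportRadius s * Real.cos θ)
      (supportRadius s * -Real.sin θ) (Set.Icc 0 Real.pi) θ := fun θ _ =>
    ((Real.hasDerivAt_cos θ).const_mul _).hasDerivWithinAt
  have hinj : Set.InjOn (fun θ => supportRadius s * Real.cos θ) (Set.Icc 0 Real.pi) :=
    fun x hx y hy hxy => Real.injOn_cos hx hy
      (mul_left_cancel₀ (supportRadius_pos hs).ne' hxy)
  have hcongr : ∀ θ ∈ Set.Icc 0 Real.pi, |supportRadius s * -Real.sin θ| •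
      (equilibriumDensity s (supportRadius s * Real.cos θ) • f (supportRadius s * Real.cos θ)) =
      Real.pi⁻¹ * (arcDensity s θ * f (supportRadius s * Real.cos θ)) := fun θ hθ => by
    rw [smul_eq_mul, smul_eq_mul, ← mul_assoc, abs_deriv_mul_equilibriumDensity hs hθ, mul_assoc]
  have hhalf : IntervalIntegrable
      (fun θ => arcDensity s θ * f (supportRadius s * Real.cos θ)) volume 0 Real.pi :=
    hf.mono_set (by
      rw [Set.uIcc_of_le hpi.le, Set.uIcc_of_le (by linarith)]
      exact Set.Icc_subset_Icc_right (by linarith))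
  have hhalf' : IntervalIntegrable
      (fun θ => arcDensity s θ * f (supportRadius s * Real.cos θ)) volume Real.pi
        (2 * Real.pi) :=
    hf.mono_set (by
      rw [Set.uIcc_of_le (by linarith), Set.uIcc_of_le (by linarith)]
      exact Set.Icc_subset_Icc_left hpi.le)
  -- The reflection `θ ↦ 2 * π - θ` exchanges the two halves of the circle.
  have hsymm : ∫ θ in Real.pi..(2 * Real.pi),
      arcDensity s θ * f (supportRadius s * Real.cos θ) =
      ∫ θ in 0..Real.pi, arcDensity s θ * f (supportRadius s * Real.cos θ) := by
    have := intervalIntegral.integral_comp_sub_left (a := 0) (b := Real.pi)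
      (fun θ => arcDensity s θ * f (supportRadius s * Real.cos θ)) (2 * Real.pi)
    simp only [arcDensity_comp_reflect, Real.cos_two_pi_sub] at this
    rw [this]
    congr 1 <;> ring
  constructor
  · rw [equilibriumMeasure, integrable_withDensity_iff_integrable_smul' hmeas hfin]
    simp only [ENNReal.toReal_ofReal (equilibriumDensity_nonneg s _)]
    change IntegrableOn _ _ _
    rw [← image_supportRadius_mul_cos hs,
      integrableOn_image_iff_integrableOn_abs_deriv_smul measurableSet_Icc hderiv hinj,
      integrableOn_congr_fun hcongr measurableSet_Icc]
    exact ((intervalIntegrable_iff_integrableOn_Icc_of_le hpi.le).1 hhalf).const_mul _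
  · rw [equilibriumMeasure, integral_withDensity_eq_integral_toReal_smul hmeas hfin]
    simp only [ENNReal.toReal_ofReal (equilibriumDensity_nonneg s _)]
    rw [← image_supportRadius_mul_cos hs,
      integral_image_eq_integral_abs_deriv_smul measurableSet_Icc hderiv hinj,
      setIntegral_congr_fun measurableSet_Icc hcongr, integral_const_mul,
      integral_Icc_eq_integral_Ioc, ← intervalIntegral.integral_of_le hpi.le,
      ← intervalIntegral.integral_add_adjacent_intervals hhalf hhalf', hsymm]
    field_simp
    ring

lemma intervalIntegral_arcDensity {s : ℝ} (hs : 1 < s) :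
    (2 * Real.pi)⁻¹ * ∫ θ in 0..(2 * Real.pi), arcDensity s θ = 1 := by
  have h := circleAverage_arcKernel hs
  simpa only [Real.circleAverage_def, arcKernel_circleMap hs, smul_eq_mul] using h

lemma continuous_arcDensity {s : ℝ} (hs : 1 < s) : Continuous (arcDensity s) := by
  unfold arcDensity
  exact Continuous.div (by fun_prop) (by fun_prop) fun θ => (arcDensity_denom_pos hs θ).ne'

lemma isProbabilityMeasure_equilibriumMeasure {s : ℝ} (hs : 1 < s) :
    IsProbabilityMeasure (equilibriumMeasure s) := by
  have h := integrable_equilibriumMeasure (f := fun _ => (1 : ℝ)) hs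
    (by simpa using (continuous_arcDensity hs).intervalIntegrable _ _)
  simp only [mul_one, intervalIntegral_arcDensity hs, integral_const, smul_eq_mul] at h
  refine ⟨?_⟩
  have h2 := h.2
  rw [Measure.real, ENNReal.toReal_eq_one_iff] at h2
  exact h2

lemma measure_preimage_circleMap (u : ℂ) : ∀ᵐ θ : ℝ, circleMap 0 1 θ ≠ u :=
  measure_eq_zero_iff_ae_notMem.1
    (((Set.countable_singleton u).preimage_circleMap 0 one_ne_zero).measure_zero volume)

/-- For `z = exp (i θ)`, the difference factors as
`b / 2 * (u + u⁻¹) - b * cos θ = b / (2 * u) * (z - u) * (z⁻¹ - u)`. -/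
lemma norm_joukowski_sub_cos {u : ℂ} (hu : u ≠ 0) {b : ℝ} (hb : 0 < b) (θ : ℝ) :
    ‖(b / 2 : ℂ) * (u + u⁻¹) - ((b * Real.cos θ : ℝ) : ℂ)‖ =
      b / 2 / ‖u‖ * ‖circleMap 0 1 θ - u‖ * ‖circleMap 0 1 θ - (starRingEnd ℂ) u‖ := by
  have hz : (starRingEnd ℂ) (circleMap 0 1 θ) * circleMap 0 1 θ = 1 := by
    rw [mul_comm, Complex.mul_conj, Complex.normSq_eq_norm_sq]
    simp
  have hcos : ((Real.cos θ : ℝ) : ℂ) =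
      (circleMap 0 1 θ + (starRingEnd ℂ) (circleMap 0 1 θ)) / 2 := by
    rw [Complex.add_conj]
    simp [circleMap, Complex.exp_re]
  have h1 : ‖circleMap 0 1 θ - (starRingEnd ℂ) u‖ = ‖(starRingEnd ℂ) (circleMap 0 1 θ) - u‖ := by
    rw [← Complex.norm_conj]
    simp
  have h2 : (b / 2 : ℂ) * (u + u⁻¹) - ((b * Real.cos θ : ℝ) : ℂ) =
      (b / 2 : ℂ) / u * (circleMap 0 1 θ - u) * ((starRingEnd ℂ) (circleMap 0 1 θ) - u) := by
    rw [Complex.ofReal_mul, hcos]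
    field_simp
    linear_combination -(b : ℂ) * hz
  rw [h1, h2, norm_mul, norm_mul, norm_div, norm_div, Complex.norm_real, Real.norm_of_nonneg hb.le]
  simp

/-- The logarithmic potential of the candidate measure at the image of `u` under the Joukowski
map. -/
lemma integral_log_norm_sub {s : ℝ} (hs : 1 < s) {u : ℂ} (hu : 1 ≤ ‖u‖) :
    Integrable (fun t : ℝ => Real.log ‖(supportRadius s / 2 : ℂ) * (u + u⁻¹) - (t : ℂ)‖)
      (equilibriumMeasure s) ∧
    ∫ t : ℝ, Real.log ‖(supportRadius s / 2 : ℂ) * (u + u⁻¹) - (t : ℂ)‖ ∂equilibriumMeasure s =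
      Real.log (supportRadius s / 2) +
        s * Real.log ‖u ^ 2 + ((1 / (2 * s - 1) : ℝ) : ℂ)‖ - (2 * s - 1) * Real.log ‖u‖ := by
  have hb := supportRadius_pos hs
  have hu0 : u ≠ 0 := norm_pos_iff.1 (by linarith)
  have hcu : 1 ≤ ‖(starRingEnd ℂ) u‖ := by simpa using hu
  have hK := continuousOn_arcKernel hs
  have i0 := hK.circleIntegrable'
  have i1 := circleIntegrable_mul_log_norm_sub hK u
  have i2 := circleIntegrable_mul_log_norm_sub hK ((starRingEnd ℂ) u)
  have a0 := circleAverage_arcKernel hs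
  have a1 := circleAverage_arcKernel_mul_log hs hu
  have a2 := circleAverage_arcKernel_mul_log hs hcu
  have hconj : ‖(starRingEnd ℂ) u ^ 2 + ((1 / (2 * s - 1) : ℝ) : ℂ)‖ =
      ‖u ^ 2 + ((1 / (2 * s - 1) : ℝ) : ℂ)‖ := by
    rw [← Complex.norm_conj (u ^ 2 + _), map_add, map_pow, Complex.conj_ofReal]
  rw [hconj, Complex.norm_conj] at a2
  set c := Real.log (supportRadius s / 2) - Real.log ‖u‖ with hc
  let g : ℂ → ℝ := c • arcKernel s + ((fun z => arcKernel s z * Real.log ‖z - u‖) +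
    fun z => arcKernel s z * Real.log ‖z - (starRingEnd ℂ) u‖)
  -- The factorisation of the logarithm fails where a factor vanishes, that is on a null set of angles.
  have hae : ∀ᵐ θ : ℝ, g (circleMap 0 1 θ) = arcDensity s θ *
      Real.log ‖(supportRadius s / 2 : ℂ) * (u + u⁻¹) -
        ((supportRadius s * Real.cos θ : ℝ) : ℂ)‖ := by
    filter_upwards [measure_preimage_circleMap u,
      measure_preimage_circleMap ((starRingEnd ℂ) u)] with θ h1 h2
    have hn1 : ‖circleMap 0 1 θ - u‖ ≠ 0 := norm_ne_zero_iff.2 (sub_ne_zero.2 h1)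
    have hn2 : ‖circleMap 0 1 θ - (starRingEnd ℂ) u‖ ≠ 0 := norm_ne_zero_iff.2 (sub_ne_zero.2 h2)
    have hn : ‖u‖ ≠ 0 := norm_ne_zero_iff.2 hu0
    rw [norm_joukowski_sub_cos hu0 hb, Real.log_mul (by positivity) hn2,
      Real.log_mul (by positivity) hn1, Real.log_div (by positivity) hn, ← hc,
      ← arcKernel_circleMap hs]
    simp only [g, Pi.add_apply, Pi.smul_apply, smul_eq_mul]
    ring
  have ig : CircleIntegrable g 0 1 := i0.const_smul.add (i1.add i2)
  have ag : Real.circleAverage g 0 1 = c + (s * Real.log ‖u ^ 2 + ((1 / (2 * s - 1) : ℝ) : ℂ)‖ -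
      2 * (s - 1) * Real.log ‖u‖) := by
    rw [Real.circleAverage_add i0.const_smul (i1.add i2), Real.circleAverage_smul,
      Real.circleAverage_add i1 i2, a0, a1, a2, smul_eq_mul]
    ring
  have key := integrable_equilibriumMeasure (f := fun t : ℝ =>
    Real.log ‖(supportRadius s / 2 : ℂ) * (u + u⁻¹) - (t : ℂ)‖) hs
    (ig.congr_ae (ae_restrict_of_ae hae))
  refine ⟨key.1, ?_⟩
  rw [key.2, ← intervalIntegral.integral_congr_ae (hae.mono fun θ h _ => h),
    ← smul_eq_mul, ← Real.circleAverage_def, ag, hc]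
  ring

/-! ### Frostman inequalities for the candidate measure -/

/-- The mean of `log (1 + t ^ 2) / 2` for the candidate measure, see `integral_log_one_add_sq`. -/
noncomputable def fieldMean (s : ℝ) : ℝ :=
  Real.log (supportRadius s / 2) + s * Real.log (4 * s * (s - 1) / (2 * s - 1)) -
    (s - 1 / 2) * Real.log (2 * s - 1)

/-- The constant value on the support of the chordal potential of the candidate measure plus
`residualField s`. -/
noncomputable def frostmanConstant (s : ℝ) : ℝ :=
  s * Real.log (2 * s) - (s - 1 / 2) * Real.log (2 * s - 1)

/-- The integrand is `log ‖i - t‖`, and `i` is the image of `i √(2 * s - 1)` under the Joukowski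
map. -/
lemma integral_log_one_add_sq {s : ℝ} (hs : 1 < s) :
    Integrable (fun t : ℝ => Real.log (1 + t ^ 2) / 2) (equilibriumMeasure s) ∧
    ∫ t : ℝ, Real.log (1 + t ^ 2) / 2 ∂equilibriumMeasure s = fieldMean s := by
  have hm : 1 < 2 * s - 1 := by linarith
  have hs1 : s - 1 ≠ 0 := by linarith
  set r := √(2 * s - 1) with hr
  have hr0 : 0 < r := Real.sqrt_pos.2 (by linarith)
  have hr2 : r ^ 2 = 2 * s - 1 := Real.sq_sqrt (by linarith)
  have hr1 : 1 ≤ r := by rw [hr, Real.one_le_sqrt]; linarith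
  have hnorm : ‖Complex.I * (r : ℂ)‖ = r := by
    rw [norm_mul, Complex.norm_I, one_mul, Complex.norm_real, Real.norm_of_nonneg hr0.le]
  have h := integral_log_norm_sub hs (u := Complex.I * r) (by rw [hnorm]; exact hr1)
  -- The parameter of the point `i`.
  have hI : (supportRadius s / 2 : ℂ) * (Complex.I * r + (Complex.I * r)⁻¹) = Complex.I := by
    have hreal : supportRadius s / 2 * (r - r⁻¹) = 1 := by
      rw [supportRadius, ← hr]
      field_simp
      rw [hr2]
      ring
    have hc : (supportRadius s / 2 : ℂ) * ((r : ℂ) - (r : ℂ)⁻¹) = 1 := by exact_mod_cast hreal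
    rw [mul_inv, Complex.inv_I]
    linear_combination Complex.I * hc
  have hfun : ∀ t : ℝ, Real.log ‖Complex.I - (t : ℂ)‖ = Real.log (1 + t ^ 2) / 2 := fun t => by
    rw [norm_sub_rev, norm_sub_I, Real.log_sqrt (by positivity)]
  have hpt : ‖(Complex.I * (r : ℂ)) ^ 2 + ((1 / (2 * s - 1) : ℝ) : ℂ)‖ =
      4 * s * (s - 1) / (2 * s - 1) := by
    have : (Complex.I * (r : ℂ)) ^ 2 + ((1 / (2 * s - 1) : ℝ) : ℂ) =
        ((-(4 * s * (s - 1) / (2 * s - 1)) : ℝ) : ℂ) := by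
      rw [mul_pow, Complex.I_sq, ← Complex.ofReal_pow, hr2, neg_one_mul, ← Complex.ofReal_neg,
        ← Complex.ofReal_add]
      congr 1
      have : 2 * s - 1 ≠ 0 := by linarith
      rw [eq_neg_iff_add_eq_zero, add_assoc, ← add_div, neg_add_eq_zero, eq_div_iff this]
      ring
    rw [this, Complex.norm_real, norm_neg, Real.norm_of_nonneg]
    exact div_nonneg (mul_nonneg (by linarith) (by linarith)) (by linarith)
  simp only [hI, hfun, hpt, hnorm] at h
  refine ⟨h.1, h.2.trans ?_⟩
  rw [fieldMean, hr, Real.log_sqrt (by linarith)]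
  ring

lemma ae_ne_equilibriumMeasure (s x : ℝ) : ∀ᵐ t ∂equilibriumMeasure s, x ≠ t := by
  have h : equilibriumMeasure s ≪ volume :=
    (withDensity_absolutelyContinuous _ _).trans Measure.restrict_le_self.absolutelyContinuous
  refine h.ae_le ?_
  have := measure_eq_zero_iff_ae_notMem.1 (Real.volume_singleton (a := x))
  filter_upwards [this] with t ht hxt
  exact ht (by simp [hxt])

/-- The chordal potential plus the field at a point `x` with Joukowski parameter `u`. The first
component says that the real number on the right is not cut off by `ENNReal.ofReal`. -/
lemma chordalPotential_add_field {s : ℝ} (hs : 1 < s) {x : ℝ} {u : ℂ} (hu : 1 ≤ ‖u‖)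
    (hx : (x : ℂ) = (supportRadius s / 2 : ℂ) * (u + u⁻¹)) :
    0 ≤ s / 2 * Real.log (1 + x ^ 2) + fieldMean s - (Real.log (supportRadius s / 2) +
        s * Real.log ‖u ^ 2 + ((1 / (2 * s - 1) : ℝ) : ℂ)‖ - (2 * s - 1) * Real.log ‖u‖) ∧
    ∫⁻ t, chordalKernel x t ∂equilibriumMeasure s + ENNReal.ofReal (residualField s x) =
      ENNReal.ofReal (s / 2 * Real.log (1 + x ^ 2) + fieldMean s -
        (Real.log (supportRadius s / 2) +
          s * Real.log ‖u ^ 2 + ((1 / (2 * s - 1) : ℝ) : ℂ)‖ -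
          (2 * s - 1) * Real.log ‖u‖)) := by
  have := isProbabilityMeasure_equilibriumMeasure hs
  obtain ⟨i1, e1⟩ := integral_log_one_add_sq hs
  obtain ⟨i2, e2⟩ := integral_log_norm_sub hs hu
  rw [← hx] at i2 e2
  have hnorm : ∀ t : ℝ, Real.log ‖(x : ℂ) - (t : ℂ)‖ = Real.log |x - t| := fun t => by
    rw [← Complex.ofReal_sub, Complex.norm_real, Real.norm_eq_abs]
  simp only [hnorm] at i2 e2
  have i3 : Integrable (fun t => Real.log (1 + x ^ 2) / 2 + Real.log (1 + t ^ 2) / 2)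
      (equilibriumMeasure s) := (integrable_const _).add i1
  have hint : Integrable (fun t => Real.log (1 + x ^ 2) / 2 + Real.log (1 + t ^ 2) / 2 -
      Real.log |x - t|) (equilibriumMeasure s) := i3.sub i2
  have hval : ∫ t, (Real.log (1 + x ^ 2) / 2 + Real.log (1 + t ^ 2) / 2 -
      Real.log |x - t|) ∂equilibriumMeasure s = Real.log (1 + x ^ 2) / 2 + fieldMean s -
      (Real.log (supportRadius s / 2) + s * Real.log ‖u ^ 2 + ((1 / (2 * s - 1) : ℝ) : ℂ)‖ -
      (2 * s - 1) * Real.log ‖u‖) := by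
    rw [integral_sub i3 i2, integral_add (integrable_const _) i1, e1, e2]
    simp
  have hne := ae_ne_equilibriumMeasure s x
  have hnn : 0 ≤ᵐ[equilibriumMeasure s] fun t => Real.log (1 + x ^ 2) / 2 +
      Real.log (1 + t ^ 2) / 2 - Real.log |x - t| := hne.mono fun t ht => chordal_log_nonneg ht
  have hl : ∫⁻ t, chordalKernel x t ∂equilibriumMeasure s =
      ENNReal.ofReal (∫ t, (Real.log (1 + x ^ 2) / 2 + Real.log (1 + t ^ 2) / 2 -
      Real.log |x - t|) ∂equilibriumMeasure s) := by
    rw [ofReal_integral_eq_lintegral_ofReal hint hnn]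
    exact lintegral_congr_ae (hne.mono fun t ht => chordalKernel_of_ne ht)
  have h0 := integral_nonneg_of_ae hnn
  have hsum : s / 2 * Real.log (1 + x ^ 2) + fieldMean s - (Real.log (supportRadius s / 2) +
        s * Real.log ‖u ^ 2 + ((1 / (2 * s - 1) : ℝ) : ℂ)‖ - (2 * s - 1) * Real.log ‖u‖) =
      ∫ t, (Real.log (1 + x ^ 2) / 2 + Real.log (1 + t ^ 2) / 2 -
      Real.log |x - t|) ∂equilibriumMeasure s + residualField s x := by
    rw [hval, residualField]
    ring
  rw [hsum, hl, ENNReal.ofReal_add h0 (residualField_nonneg hs x)]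
  exact ⟨add_nonneg h0 (residualField_nonneg hs x), rfl⟩

lemma fieldMean_sub {s : ℝ} (hs : 1 < s) :
    fieldMean s - Real.log (supportRadius s / 2) + s * Real.log ((2 * s - 1) / (2 * (s - 1))) =
      frostmanConstant s := by
  have h1 : 0 < s - 1 := by linarith
  have h2 : 0 < 2 * s - 1 := by linarith
  have h3 : Real.log (4 * s * (s - 1) / (2 * s - 1)) +
      Real.log ((2 * s - 1) / (2 * (s - 1))) = Real.log (2 * s) := by
    rw [← Real.log_mul (by positivity) (by positivity)]
    congr 1
    rw [div_mul_div_comm, div_eq_iff (by positivity)]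
    ring
  rw [fieldMean, frostmanConstant, ← h3]
  ring

lemma chordalPotential_on_support {s : ℝ} (hs : 1 < s) {x : ℝ} (hx : |x| ≤ supportRadius s) :
    0 ≤ frostmanConstant s ∧
    ∫⁻ t, chordalKernel x t ∂equilibriumMeasure s + ENNReal.ofReal (residualField s x) =
      ENNReal.ofReal (frostmanConstant s) := by
  have hb := supportRadius_pos hs
  have hs1 : 0 < s - 1 := by linarith
  have hm : 0 < 2 * s - 1 := by linarith
  obtain ⟨hx1, hx2⟩ := abs_le.1 hx
  -- A point of the support is the image of the point `exp (i φ)` of the unit circle.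
  set φ := Real.arccos (x / supportRadius s) with hφ
  have hcos : Real.cos φ = x / supportRadius s :=
    Real.cos_arccos (by rw [le_div_iff₀ hb]; linarith) (by rw [div_le_iff₀ hb]; linarith)
  have hnorm : ‖circleMap 0 1 φ‖ = 1 := by simp
  have hu : (x : ℂ) = (supportRadius s / 2 : ℂ) * (circleMap 0 1 φ + (circleMap 0 1 φ)⁻¹) := by
    have : (circleMap 0 1 φ)⁻¹ = (starRingEnd ℂ) (circleMap 0 1 φ) := by
      rw [Complex.inv_def, Complex.normSq_eq_norm_sq, hnorm]
      simp
    rw [this, Complex.add_conj]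
    have hre : (circleMap 0 1 φ).re = Real.cos φ := by simp [circleMap, Complex.exp_re]
    rw [hre, hcos]
    push_cast
    have : (supportRadius s : ℂ) ≠ 0 := by exact_mod_cast hb.ne'
    field_simp
  have hsq : ‖circleMap 0 1 φ ^ 2 + ((1 / (2 * s - 1) : ℝ) : ℂ)‖ =
      √(1 + x ^ 2) / ((2 * s - 1) / (2 * (s - 1))) := by
    have hpow : circleMap 0 1 φ ^ 2 =
        ((Real.cos φ ^ 2 - Real.sin φ ^ 2 : ℝ) : ℂ) +
          ((2 * Real.sin φ * Real.cos φ : ℝ) : ℂ) * Complex.I := by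
      have : circleMap 0 1 φ = (Real.cos φ : ℂ) + (Real.sin φ : ℂ) * Complex.I := by
        simp [circleMap, Complex.exp_mul_I]
      rw [this]
      push_cast
      linear_combination (Complex.sin φ) ^ 2 * Complex.I_sq
    -- With `ρ = 1 / (2 * s - 1)`, `‖exp (2 i φ) + ρ‖ ^ 2 = (1 - ρ) ^ 2 + 4 * ρ * cos φ ^ 2` is a
    -- constant multiple of `1 + x ^ 2`.
    have hx2' : x ^ 2 = (2 * s - 1) / (s - 1) ^ 2 * Real.cos φ ^ 2 := by
      rw [← supportRadius_sq hs, hcos]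
      field_simp
    have : √(1 + x ^ 2) / ((2 * s - 1) / (2 * (s - 1))) =
        √((1 + x ^ 2) / ((2 * s - 1) / (2 * (s - 1))) ^ 2) := by
      rw [Real.sqrt_div (by positivity), Real.sqrt_sq (by positivity)]
    rw [this, Complex.norm_def, hpow, Complex.normSq_apply]
    congr 1
    have e1 : (((Real.cos φ ^ 2 - Real.sin φ ^ 2 : ℝ) : ℂ) +
          ((2 * Real.sin φ * Real.cos φ : ℝ) : ℂ) * Complex.I + ((1 / (2 * s - 1) : ℝ) : ℂ)).re =
        Real.cos φ ^ 2 - Real.sin φ ^ 2 + 1 / (2 * s - 1) := by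
      simp only [Complex.add_re, Complex.ofReal_re, Complex.re_ofReal_mul, Complex.I_re, mul_zero,
        add_zero]
    have e2 : (((Real.cos φ ^ 2 - Real.sin φ ^ 2 : ℝ) : ℂ) +
          ((2 * Real.sin φ * Real.cos φ : ℝ) : ℂ) * Complex.I + ((1 / (2 * s - 1) : ℝ) : ℂ)).im =
        2 * Real.sin φ * Real.cos φ := by
      simp only [Complex.add_im, Complex.ofReal_im, Complex.im_ofReal_mul, Complex.I_im, mul_one,
        zero_add, add_zero]
    rw [e1, e2, hx2']
    have hsin : (2 * Real.sin φ * Real.cos φ) * (2 * Real.sin φ * Real.cos φ) =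
        4 * (1 - Real.cos φ ^ 2) * Real.cos φ ^ 2 := by
      rw [← Real.sin_sq]; ring
    rw [hsin, Real.sin_sq]
    generalize Real.cos φ = y
    generalize hE : 2 * s - 1 = E at *
    have hE' : s = (E + 1) / 2 := by linarith
    have hE1 : E - 1 ≠ 0 := by intro h; apply hs1.ne'; linarith
    have hs1' : s - 1 = (E - 1) / 2 := by linarith
    rw [hs1']
    field_simp
    ring
  have h := chordalPotential_add_field hs (x := x) (u := circleMap 0 1 φ) hnorm.ge hu
  have hF : s / 2 * Real.log (1 + x ^ 2) + fieldMean s - (Real.log (supportRadius s / 2) +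
        s * Real.log ‖circleMap 0 1 φ ^ 2 + ((1 / (2 * s - 1) : ℝ) : ℂ)‖ -
          (2 * s - 1) * Real.log ‖circleMap 0 1 φ‖) = frostmanConstant s := by
    rw [← fieldMean_sub hs, hsq, hnorm,
      Real.log_div (x := √(1 + x ^ 2)) (by positivity) (by positivity),
      Real.log_sqrt (by positivity), Real.log_one]
    ring
  rw [hF] at h
  exact h

/-- Both sides agree at `y = 1`, and the derivative of the difference is
`(m - 1) * m * (y - 1) ^ 2 / (y * (m * y + 1) * (y + m))`. -/
lemma log_ratio_le {m y : ℝ} (hm : 1 < m) (hy : 1 ≤ y) :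
    (m + 1) * (Real.log (m * y + 1) - Real.log (y + m)) ≤ (m - 1) * Real.log y := by
  set g : ℝ → ℝ := fun y => (m - 1) * Real.log y -
    (m + 1) * (Real.log (m * y + 1) - Real.log (y + m)) with hg
  have hd : ∀ y : ℝ, 0 < y → HasDerivAt g ((m - 1) * y⁻¹ -
      (m + 1) * (m * 1 / (m * y + 1) - 1 / (y + m))) y := fun y hy => by
    refine ((Real.hasDerivAt_log hy.ne').const_mul _).sub (HasDerivAt.const_mul _ (.sub ?_ ?_))
    · exact (((hasDerivAt_id y).const_mul m).add_const 1).log (by simp; positivity)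
    · exact ((hasDerivAt_id y).add_const m).log (by simp; positivity)
  have hmono : MonotoneOn g (Set.Ici 1) := by
    refine monotoneOn_of_hasDerivWithinAt_nonneg (convex_Ici 1)
      (fun y hy => (hd y (zero_lt_one.trans_le hy)).continuousAt.continuousWithinAt)
      (fun y hy => (hd y ?_).hasDerivWithinAt) fun y hy => ?_
    · rw [interior_Ici] at hy
      exact zero_lt_one.trans hy
    · rw [interior_Ici] at hy
      have hy0 : 0 < y := zero_lt_one.trans hy
      have : (m - 1) * y⁻¹ - (m + 1) * (m * 1 / (m * y + 1) - 1 / (y + m)) =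
          (m - 1) * m * (y - 1) ^ 2 / (y * (m * y + 1) * (y + m)) := by
        have : m * y + 1 ≠ 0 := by positivity
        have : y + m ≠ 0 := by positivity
        field_simp
        ring
      rw [this]
      have : 0 ≤ m - 1 := by linarith
      positivity
  have h := hmono Set.self_mem_Ici hy hy
  have h1 : g 1 = 0 := by
    simp only [hg, Real.log_one, mul_one, mul_zero, add_comm 1 m, sub_self]
  rw [h1] at h
  simp only [hg] at h
  linarith

/-- Outside `[-b, b]` the Joukowski parameter can be chosen real. -/
lemma exists_joukowski_preimage {b x : ℝ} (hb : 0 < b) (hx : b < |x|) :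
    ∃ u : ℝ, 1 ≤ |u| ∧ x = b / 2 * (u + u⁻¹) := by
  have key : ∀ z : ℝ, b < z → ∃ u : ℝ, 1 ≤ |u| ∧ z = b / 2 * (u + u⁻¹) := fun z hz => by
    have hnn : 0 ≤ z ^ 2 - b ^ 2 := by nlinarith
    have hr := Real.sq_sqrt hnn
    have hr0 := Real.sqrt_nonneg (z ^ 2 - b ^ 2)
    generalize √(z ^ 2 - b ^ 2) = r at *
    have hpos : 0 < z + r := by linarith
    refine ⟨(z + r) / b, ?_, ?_⟩
    · rw [abs_of_pos (by positivity), le_div_iff₀ hb]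
      linarith
    · rw [inv_div]
      field_simp
      linear_combination -hr
  rcases le_total 0 x with h | h
  · rw [abs_of_nonneg h] at hx
    exact key x hx
  · rw [abs_of_nonpos h] at hx
    obtain ⟨u, h1, h2⟩ := key (-x) hx
    exact ⟨-u, by rwa [abs_neg], by rw [inv_neg]; linarith⟩

lemma frostman_le_off_support {s : ℝ} (hs : 1 < s) {x : ℝ} (hx : supportRadius s < |x|) :
    ENNReal.ofReal (frostmanConstant s) ≤
      ∫⁻ t, chordalKernel x t ∂equilibriumMeasure s + ENNReal.ofReal (residualField s x) := by
  have hb := supportRadius_pos hs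
  have hs1 : 0 < s - 1 := by linarith
  have hm : 0 < 2 * s - 1 := by linarith
  obtain ⟨u, hu1, hxu⟩ := exists_joukowski_preimage hb hx
  have hu0 : u ≠ 0 := abs_pos.1 (by linarith)
  have hnorm : ‖(u : ℂ)‖ = |u| := by rw [Complex.norm_real, Real.norm_eq_abs]
  rw [(chordalPotential_add_field hs (x := x) (u := (u : ℂ)) (by rwa [hnorm])
    (by rw [hxu]; push_cast; ring)).2]
  refine ENNReal.ofReal_le_ofReal ?_
  have hy : 1 ≤ u ^ 2 := by rw [← sq_abs]; exact one_le_pow₀ hu1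
  have hpt : ‖(u : ℂ) ^ 2 + ((1 / (2 * s - 1) : ℝ) : ℂ)‖ =
      ((2 * s - 1) * u ^ 2 + 1) / (2 * s - 1) := by
    rw [← Complex.ofReal_pow, ← Complex.ofReal_add, Complex.norm_real,
      Real.norm_of_nonneg (by positivity)]
    field_simp
  have h1 : 1 + x ^ 2 = ((2 * s - 1) * u ^ 2 + 1) * (u ^ 2 + (2 * s - 1)) /
      ((2 * (s - 1)) ^ 2 * u ^ 2) := by
    rw [hxu, mul_pow, div_pow, supportRadius_sq hs]
    field_simp
    ring
  have hlogu : Real.log |u| = Real.log (u ^ 2) / 2 := by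
    rw [← sq_abs, Real.log_pow]
    push_cast
    ring
  have h := log_ratio_le (m := 2 * s - 1) (y := u ^ 2) (by linarith) hy
  rw [← fieldMean_sub hs, hpt, hnorm, hlogu, h1,
    Real.log_div (x := ((2 * s - 1) * u ^ 2 + 1) * (u ^ 2 + (2 * s - 1))) (by positivity)
      (by positivity),
    Real.log_mul (by positivity) (by positivity), Real.log_mul (by positivity) (by positivity),
    Real.log_pow (n := 2) (x := 2 * (s - 1)),
    Real.log_div (x := (2 * s - 1) * u ^ 2 + 1) (by positivity) (by positivity),
    Real.log_div (x := 2 * s - 1) (by positivity) (by positivity)]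
  push_cast
  nlinarith

lemma frostman_le {s : ℝ} (hs : 1 < s) (x : ℝ) :
    ENNReal.ofReal (frostmanConstant s) ≤
      ∫⁻ t, chordalKernel x t ∂equilibriumMeasure s + ENNReal.ofReal (residualField s x) := by
  rcases le_or_gt |x| (supportRadius s) with h | h
  · exact (chordalPotential_on_support hs h).2.ge
  · exact frostman_le_off_support hs h

lemma frostman_ae_eq {s : ℝ} (hs : 1 < s) : ∀ᵐ x ∂equilibriumMeasure s,
    ∫⁻ t, chordalKernel x t ∂equilibriumMeasure s + ENNReal.ofReal (residualField s x) =
      ENNReal.ofReal (frostmanConstant s) := by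
  refine (withDensity_absolutelyContinuous _ _).ae_le ?_
  filter_upwards [ae_restrict_mem measurableSet_Icc] with x hx
  exact (chordalPotential_on_support hs (abs_le.2 hx)).2

/-! ### Minimal energy, support and capacity -/

lemma fieldMean_nonneg {s : ℝ} (hs : 1 < s) : 0 ≤ fieldMean s := by
  rw [← (integral_log_one_add_sq hs).2]
  refine integral_nonneg fun t => ?_
  have : 0 ≤ Real.log (1 + t ^ 2) := Real.log_nonneg (by nlinarith [sq_nonneg t])
  positivity

lemma energy_equilibriumMeasure {s : ℝ} (hs : 1 < s) :
    energy (weight 1 s) (equilibriumMeasure s) =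
      ((frostmanConstant s + (s - 1) * fieldMean s : ℝ) : EReal) := by
  have := isProbabilityMeasure_equilibriumMeasure hs
  have hJ := integral_log_one_add_sq hs
  have hF := (chordalPotential_on_support hs (x := 0)
    (by rw [abs_zero]; exact (supportRadius_pos hs).le)).1
  have hq : ∫⁻ x, ENNReal.ofReal (residualField s x) ∂equilibriumMeasure s =
      ENNReal.ofReal ((s - 1) * fieldMean s) := by
    have : ∀ x, residualField s x = (s - 1) * (Real.log (1 + x ^ 2) / 2) := fun x => by
      rw [residualField]; ring
    rw [← hJ.2, ← integral_const_mul, ofReal_integral_eq_lintegral_ofReal (hJ.1.const_mul _)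
      (Filter.Eventually.of_forall fun x => by
        change 0 ≤ (s - 1) * (Real.log (1 + x ^ 2) / 2)
        rw [← this]
        exact residualField_nonneg hs x)]
    simp only [this]
  have hnn : 0 ≤ (s - 1) * fieldMean s := mul_nonneg (by linarith) (fieldMean_nonneg hs)
  rw [energy_weight hs, two_mul, ← add_assoc, chordalEnergy_self_add (frostman_ae_eq hs), hq,
    ← ENNReal.ofReal_add hF hnn, EReal.coe_ennreal_ofReal, max_eq_left (add_nonneg hF hnn)]

lemma energy_equilibriumMeasure_le {s : ℝ} (hs : 1 < s) (μ : Measure ℝ) [IsProbabilityMeasure μ] :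
    energy (weight 1 s) (equilibriumMeasure s) ≤ energy (weight 1 s) μ ∧
    (energy (weight 1 s) μ ≤ energy (weight 1 s) (equilibriumMeasure s) →
      μ = equilibriumMeasure s) := by
  have := isProbabilityMeasure_equilibriumMeasure hs
  rw [energy_weight hs, energy_weight hs, EReal.coe_ennreal_le_coe_ennreal_iff,
    EReal.coe_ennreal_le_coe_ennreal_iff]
  exact frostman_minimal (frostman_le hs) (frostman_ae_eq hs) μ

lemma minEnergy_weight {s : ℝ} (hs : 1 < s) :
    minEnergy (weight 1 s) = energy (weight 1 s) (equilibriumMeasure s) := by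
  have h := isProbabilityMeasure_equilibriumMeasure hs
  exact le_antisymm (iInf_le (fun μ : ProbabilityMeasure ℝ => energy (weight 1 s) (μ : Measure ℝ))
    ⟨equilibriumMeasure s, h⟩) (le_iInf fun μ => (energy_equilibriumMeasure_le hs μ).1)

lemma isEquilibriumMeasure_iff {s : ℝ} (hs : 1 < s) (μ : Measure ℝ) :
    IsEquilibriumMeasure (weight 1 s) μ ↔ μ = equilibriumMeasure s := by
  constructor
  · rintro ⟨h, he⟩
    exact (energy_equilibriumMeasure_le hs μ).2 (by rw [he, minEnergy_weight hs])
  · rintro rfl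
    exact ⟨isProbabilityMeasure_equilibriumMeasure hs, (minEnergy_weight hs).symm⟩

lemma support_equilibriumMeasure {s : ℝ} (hs : 1 < s) :
    (equilibriumMeasure s).support = Set.Icc (-supportRadius s) (supportRadius s) := by
  have hb := supportRadius_pos hs
  refine Set.Subset.antisymm (Measure.support_subset_of_isClosed isClosed_Icc ?_) ?_
  · exact (withDensity_absolutelyContinuous _ _).ae_le (ae_restrict_mem measurableSet_Icc)
  · rw [← closure_Ioo (by linarith : -supportRadius s ≠ supportRadius s)]
    refine closure_minimal (fun x hx => ?_) Measure.isClosed_support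
    rw [Measure.mem_support_iff_forall]
    intro U hU
    by_contra hzero
    have hmeas : Measurable fun x => ENNReal.ofReal (equilibriumDensity s x) :=
      (continuous_equilibriumDensity s).measurable.ennreal_ofReal
    rw [not_lt, nonpos_iff_eq_zero, equilibriumMeasure, withDensity_apply_eq_zero hmeas] at hzero
    have hpos : ∀ y ∈ Set.Ioo (-supportRadius s) (supportRadius s),
        0 < equilibriumDensity s y := fun y hy => by
      have hs1 : 0 < s - 1 := by linarith
      have hsq : y ^ 2 < supportRadius s ^ 2 := sq_lt_sq' hy.1 hy.2
      rw [supportRadius_sq hs, lt_div_iff₀ (by positivity)] at hsq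
      have hpi := Real.pi_pos
      refine div_pos (Real.sqrt_pos.2 (by linarith)) (by positivity)
    have hsub : Set.Ioo (-supportRadius s) (supportRadius s) ∩ interior U ⊆
        {x | ENNReal.ofReal (equilibriumDensity s x) ≠ 0} ∩ U := fun y hy =>
      ⟨(ENNReal.ofReal_pos.2 (hpos y hy.1)).ne', interior_subset hy.2⟩
    have hvol : volume (Set.Ioo (-supportRadius s) (supportRadius s) ∩ interior U) = 0 := by
      have := measure_mono_null hsub hzero
      rwa [Measure.restrict_apply' measurableSet_Icc, Set.inter_eq_left.2
        (Set.inter_subset_left.trans Set.Ioo_subset_Icc_self)] at this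
    exact ((isOpen_Ioo.inter isOpen_interior).measure_pos volume
      ⟨x, hx, mem_interior_iff_mem_nhds.2 hU⟩).ne' hvol

lemma exp_neg_minimal_energy {s : ℝ} (hs : 1 < s) :
    Real.exp (-(frostmanConstant s + (s - 1) * fieldMean s)) =
      (2 : ℝ) ^ (2 * s - 2 * s ^ 2 - 1) * s ^ (-s ^ 2) * (s - 1) ^ (-(s - 1) ^ 2) *
          (2 * s - 1) ^ ((2 * s - 1) ^ 2 / 2) := by
  have h0 : 0 < s := by linarith
  have h1 : 0 < s - 1 := by linarith
  have h2 : 0 < 2 * s - 1 := by linarith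
  rw [Real.rpow_def_of_pos two_pos, Real.rpow_def_of_pos h0, Real.rpow_def_of_pos h1,
    Real.rpow_def_of_pos h2, ← Real.exp_add, ← Real.exp_add, ← Real.exp_add]
  congr 1
  have e1 : Real.log (2 * s) = Real.log 2 + Real.log s := Real.log_mul two_ne_zero h0.ne'
  have e2 : Real.log (supportRadius s / 2) =
      Real.log (2 * s - 1) / 2 - Real.log (s - 1) - Real.log 2 := by
    rw [Real.log_div (supportRadius_pos hs).ne' two_ne_zero, supportRadius,
      Real.log_div (by positivity) h1.ne', Real.log_sqrt h2.le]
  have e3 : Real.log (4 * s * (s - 1) / (2 * s - 1)) =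
      2 * Real.log 2 + Real.log s + Real.log (s - 1) - Real.log (2 * s - 1) := by
    rw [Real.log_div (by positivity) h2.ne', Real.log_mul (by positivity) h1.ne',
      Real.log_mul (by norm_num) h0.ne', (by norm_num : (4 : ℝ) = 2 ^ 2), Real.log_pow]
    push_cast
    ring
  rw [frostmanConstant, fieldMean, e1, e2, e3]
  ring

lemma capacity_weight {s : ℝ} (hs : 1 < s) :
    capacity (weight 1 s) = ENNReal.ofReal
      ((2 : ℝ) ^ (2 * s - 2 * s ^ 2 - 1) * s ^ (-s ^ 2) * (s - 1) ^ (-(s - 1) ^ 2) *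
          (2 * s - 1) ^ ((2 * s - 1) ^ 2 / 2)) := by
  rw [capacity, minEnergy_weight hs, energy_equilibriumMeasure hs, ← EReal.coe_neg,
    EReal.exp_coe, exp_neg_minimal_energy hs]

end WeightedPotential

theorem theorem2p1 (s : ℝ) (hs : 1 < s) :
    (∃! μ : Measure ℝ,
      WeightedPotential.IsEquilibriumMeasure (WeightedPotential.weight 1 s) μ) ∧
    (∀ μ : Measure ℝ, WeightedPotential.IsEquilibriumMeasure (WeightedPotential.weight 1 s) μ →
      μ.support = Set.Icc (-(√(2 * s - 1) / (s - 1))) (√(2 * s - 1) / (s - 1)) ∧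
      μ = (volume.restrict
            (Set.Icc (-(√(2 * s - 1) / (s - 1))) (√(2 * s - 1) / (s - 1)))).withDensity
          (fun x : ℝ => ENNReal.ofReal
            (√(2 * s - 1 - (s - 1) ^ 2 * x ^ 2) / (Real.pi * (1 + x ^ 2))))) ∧
    WeightedPotential.capacity (WeightedPotential.weight 1 s) =
      ENNReal.ofReal
        ((2 : ℝ) ^ (2 * s - 2 * s ^ 2 - 1) * s ^ (-s ^ 2) * (s - 1) ^ (-(s - 1) ^ 2) *
          (2 * s - 1) ^ ((2 * s - 1) ^ 2 / 2)) := by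
  refine ⟨⟨WeightedPotential.equilibriumMeasure s,
    (WeightedPotential.isEquilibriumMeasure_iff hs _).2 rfl,
    fun μ hμ => (WeightedPotential.isEquilibriumMeasure_iff hs μ).1 hμ⟩, fun μ hμ => ?_,
    WeightedPotential.capacity_weight hs⟩
  obtain rfl := (WeightedPotential.isEquilibriumMeasure_iff hs μ).1 hμ
  exact ⟨WeightedPotential.support_equilibriumMeasure hs, rfl⟩
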